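/- Let $p$ be an odd prime, let $h\ge 1$, $q=p^h$, $l>2$ and $1\le d\le 2lh-1$ be integers such that $\gcd(l,d)=1$ and $l+d$ is odd. Let $\beta$ be a nonsquare of $\mathbb{F}_{q^{2l}}$ and let $\omega\in\mathbb{F}_{q^{2l}}$ be nonzero with $\omega+\omega^{q^l}=0$. Let $BH(q,l,d)=(\mathbb{F}_{q^{2l}},+,*)$ be the Budaghyan--Helleseth presemifield, with multiplication $$x* y=x^{q^l}y+xy^{q^l}+\left(\beta(x^{q^d}y+xy^{q^d})+\beta^{q^l}(x^{q^d}y+xy^{q^d})^{q^l}\right)\omega .$$ An autotopism of $BH(q,l,d)$ is a triple $(M,N,L)$ of $\mathbb{F}_p$-linear permutations of $\mathbb{F}_{q^{2l}}$ such that $L(x* y)=M(x)* N(y)$ for all $x,y$; it is strong if $M=N$. The autotopisms form a group under componentwise composition. Let $\star$ be the multiplication of the associated semifield, defined by $(x*1)\star(1*y)=x*y$, and let $N_m=\{a : (x\star a)\star y=x\star(a\star y)\text{ for all }x,y\}$ be its middle nucleus. Then every autotopism of $BH(q,l,d)$ is a strong autotopism up to the middle nucleus: if $(M,N,L)$ is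 an autotopism of $BH(q,l,d)$, then there are a nonzero $\gamma\in N_m$ and a strong autotopism $(N_0,N_0,L)$ of $BH(q,l,d)$ such that, for all $x$, $$M(x)*1=\gamma\star\bigl(N_0(x)*1\bigr)\quad\text{and}\quad N_0(x)*1=\gamma\star\bigl(N(x)*1\bigr).$$ Moreover, the autotopism group of $BH(q,l,d)$ has order $2lh(q^l-1)(q^2-1)$. -/

import Mathlib

/-- A multiplication `mul` on the additive group of `F` makes `F` a presemifield: both distributive
laws hold and there are no zero divisors. -/
structure IsPresemifield {F : Type*} [AddCommGroup F] (mul : F → F → F) : Prop where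
  add_mul : ∀ x y z, mul (x + y) z = mul x z + mul y z
  mul_add : ∀ x y z, mul x (y + z) = mul x y + mul x z
  eq_zero_or_eq_zero : ∀ x y, mul x y = 0 → x = 0 ∨ y = 0

/-- The triple `(M, N, L)` of `𝔽_p`-linear permutations of `F` is an isotopism from `(F, +, mul₁)`
to `(F, +, mul₂)`. -/
def IsIsotopism {p : ℕ} {F : Type*} [Field F] [Algebra (ZMod p) F] (mul₁ mul₂ : F → F → F)
    (M N L : F ≃ₗ[ZMod p] F) : Prop :=
  ∀ x y, L (mul₁ x y) = mul₂ (M x) (N y)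

/-- An autotopism is an isotopism from `(F, +, mul)` to itself. -/
def IsAutotopism {p : ℕ} {F : Type*} [Field F] [Algebra (ZMod p) F] (mul : F → F → F)
    (M N L : F ≃ₗ[ZMod p] F) : Prop :=
  IsIsotopism mul mul M N L

/-- The pair `(N, L)` represents the strong autotopism `(N, N, L)`. -/
def IsStrongAutotopism {p : ℕ} {F : Type*} [Field F] [Algebra (ZMod p) F] (mul : F → F → F)
    (N L : F ≃ₗ[ZMod p] F) : Prop :=
  IsAutotopism mul N N L

/-- The autotopism group: all autotopisms `(M, N, L)`, under componentwise composition. -/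
def autotopismGroup (p : ℕ) {F : Type*} [Field F] [Algebra (ZMod p) F] (mul : F → F → F) :
    Subgroup ((F ≃ₗ[ZMod p] F) × (F ≃ₗ[ZMod p] F) × (F ≃ₗ[ZMod p] F)) where
  carrier := {t | IsAutotopism mul t.1 t.2.1 t.2.2}
  mul_mem' := by
    intro s t hs ht x y
    change s.2.2 (t.2.2 (mul x y)) = mul (s.1 (t.1 x)) (s.2.1 (t.2.1 y))
    rw [ht, hs]
  one_mem' := fun _ _ => rfl
  inv_mem' := by
    intro t ht x y
    change t.2.2.symm (mul x y) = mul (t.1.symm x) (t.2.1.symm y)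
    rw [LinearEquiv.symm_apply_eq, ht]
    simp

/-- The multiplication `⋆` determined by `(x * e) ⋆ (e * y) = x * y`
(see `isotopeMul_apply`: for a finite presemifield and `e ≠ 0` the two maps that are inverted
here are bijections). -/
noncomputable def isotopeMul {F : Type*} [Nonempty F] (mul : F → F → F) (e : F) (u v : F) : F :=
  mul (Function.invFun (fun x => mul x e) u) (Function.invFun (fun y => mul e y) v)

theorem isotopeMul_apply {F : Type*} [AddCommGroup F] {mul : F → F → F}
    (hmul : IsPresemifield mul) {e : F} (he : e ≠ 0) (x y : F) :
    isotopeMul mul e (mul x e) (mul e y) = mul x y := by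
  have h1 : Function.Injective (fun x => mul x e) := by
    intro a b hab
    have h2 : mul (a - b) e = 0 := by
      have h3 := hmul.add_mul (a - b) b e
      rw [sub_add_cancel] at h3
      have h4 : mul a e = mul b e := hab
      rw [h4] at h3
      exact right_eq_add.mp h3
    exact sub_eq_zero.mp ((hmul.eq_zero_or_eq_zero _ _ h2).resolve_right he)
  have h1' : Function.Injective (fun y => mul e y) := by
    intro a b hab
    have h2 : mul e (a - b) = 0 := by
      have h3 := hmul.mul_add e (a - b) b
      rw [sub_add_cancel] at h3
      have h4 : mul e a = mul e b := hab
      rw [h4] at h3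
      exact right_eq_add.mp h3
    exact sub_eq_zero.mp ((hmul.eq_zero_or_eq_zero _ _ h2).resolve_left he)
  unfold isotopeMul
  rw [Function.leftInverse_invFun h1 x, Function.leftInverse_invFun h1' y]

/-- The middle nucleus of `(F, +, star)`. -/
def middleNucleus {F : Type*} (star : F → F → F) : Set F :=
  {a | ∀ x y, star (star x a) y = star x (star a y)}

/-- The multiplication of the Budaghyan-Helleseth presemifield `BH(q, l, d)`, with the auxiliary
parameters `β` (a nonsquare) and `ω` (nonzero with `ω + ω ^ q ^ l = 0`). -/
def bhMul {F : Type*} [Field F] (q l d : ℕ) (β ω : F) (x y : F) : F :=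
  x ^ q ^ l * y + x * y ^ q ^ l +
    (β * (x ^ q ^ d * y + x * y ^ q ^ d) +
      β ^ q ^ l * (x ^ q ^ d * y + x * y ^ q ^ d) ^ q ^ l) * ω

/-- The multiplication `⋆` of the semifield attached to `BH(q, l, d)`, which is given by
`(x * 1) ⋆ (1 * y) = x * y`. -/
noncomputable def bhSemifieldMul {F : Type*} [Field F] (q l d : ℕ) (β ω : F) : F → F → F :=
  isotopeMul (bhMul q l d β ω) 1

/-- `BH(q, l, d)` is a presemifield, so that the semifield multiplication `⋆` above makes sense. -/
theorem isPresemifield_bhMul {p h l d q : ℕ} [Fact p.Prime] (hp : p ≠ 2)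
    (hld : Nat.Coprime l d) (hodd : Odd (l + d)) (hq : q = p ^ h)
    {F : Type*} [Field F] [Finite F] [Algebra (ZMod p) F] (hF : Nat.card F = q ^ (2 * l))
    {β ω : F} (hβ : ¬ IsSquare β) (hω : ω ≠ 0) (hω' : ω + ω ^ q ^ l = 0) :
    IsPresemifield (bhMul q l d β ω) := by
  have : Fintype F := Fintype.ofFinite F
  have hc : CharP F p := charP_of_injective_algebraMap (algebraMap (ZMod p) F).injective p
  have hpodd : Odd p := (Fact.out : p.Prime).odd_of_ne_two hp
  have hqodd : Odd q := hq ▸ hpodd.pow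
  have hadd : ∀ (k : ℕ) (x y : F), (x + y) ^ q ^ k = x ^ q ^ k + y ^ q ^ k := by
    intro k x y
    rw [hq, ← pow_mul]
    exact add_pow_char_pow x y p (h * k)
  have h2 : (2 : F) ≠ 0 := by
    have h3 : ringChar F ≠ 2 := by rw [ringChar.eq F p]; exact hp
    exact Ring.two_ne_zero h3
  have hcard : Fintype.card F = q ^ l * q ^ l := by
    rw [← Nat.card_eq_fintype_card, hF, two_mul, pow_add]
  have hQQ : ∀ z : F, (z ^ q ^ l) ^ q ^ l = z := by
    intro z
    rw [← pow_mul, ← hcard, FiniteField.pow_card]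
  have hodd' : ∀ k, Odd (q ^ k) := fun k => hqodd.pow
  have hneg : ∀ z : F, z = -z → z = 0 := by
    intro z hz
    have : (2 : F) * z = 0 := by linear_combination hz
    exact (mul_eq_zero.mp this).resolve_left h2
  refine ⟨?_, ?_, ?_⟩
  · intro x y z
    unfold bhMul
    rw [hadd l x y, hadd d x y,
      show (x ^ q ^ d + y ^ q ^ d) * z + (x + y) * z ^ q ^ d =
        (x ^ q ^ d * z + x * z ^ q ^ d) + (y ^ q ^ d * z + y * z ^ q ^ d) by ring, hadd l]
    ring
  · intro x y z
    unfold bhMul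
    rw [hadd l y z, hadd d y z,
      show x ^ q ^ d * (y + z) + x * (y ^ q ^ d + z ^ q ^ d) =
        (x ^ q ^ d * y + x * y ^ q ^ d) + (x ^ q ^ d * z + x * z ^ q ^ d) by ring, hadd l]
    ring
  · intro x y hxy
    by_contra! hne
    obtain ⟨hx, hy⟩ := hne
    unfold bhMul at hxy
    set s := x ^ q ^ d * y + x * y ^ q ^ d with hs
    have hωQ : ω ^ q ^ l = -ω := by linear_combination hω'
    have hxy' := congrArg (· ^ q ^ l) hxy
    simp only [hadd, mul_pow, hQQ, hωQ] at hxy'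
    rw [zero_pow (hodd' l).pos.ne'] at hxy'
    have hT1 : x ^ q ^ l * y + x * y ^ q ^ l = 0 := by
      apply (mul_eq_zero.mp _).resolve_left h2
      linear_combination hxy + hxy'
    have hT2 : β * s + β ^ q ^ l * s ^ q ^ l = 0 := by
      rw [hT1, zero_add] at hxy
      exact (mul_eq_zero.mp hxy).resolve_right hω
    obtain ⟨u, rfl⟩ : ∃ u, x = u * y := ⟨x / y, by field_simp⟩
    have hu : u ≠ 0 := left_ne_zero_of_mul hx
    have huQ : u ^ q ^ l = -u := by
      have h3 : (u ^ q ^ l + u) * y ^ (q ^ l + 1) = 0 := by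
        rw [mul_pow] at hT1
        linear_combination hT1
      have := (mul_eq_zero.mp h3).resolve_right (pow_ne_zero _ hy)
      linear_combination this
    have hv : u ^ q ^ d + u ≠ 0 := by
      intro hv
      have hud : u ^ q ^ d = -u := by linear_combination hv
      have hit : ∀ (n : ℕ) (z : F), (fun z : F => z ^ q)^[n] z = z ^ q ^ n := by
        intro n z
        induction n with
        | zero => simp
        | succ n ih => rw [Function.iterate_succ_apply', ih, pow_succ, pow_mul]
      have hper : ∀ n, u ^ q ^ n = -u → Function.IsPeriodicPt (fun z : F => z ^ q) n (u ^ 2) := by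
        intro n hn
        unfold Function.IsPeriodicPt Function.IsFixedPt
        rw [hit, ← pow_mul, mul_comm, pow_mul, hn, neg_sq]
      have hg := (hper l huQ).gcd (hper d hud)
      rw [hld.gcd_eq_one] at hg
      have hg' : (u ^ q) ^ 2 = u ^ 2 := by
        have h3 : (u ^ 2) ^ q = u ^ 2 := hg
        rw [← h3, ← pow_mul, ← pow_mul, mul_comm]
      rcases sq_eq_sq_iff_eq_or_eq_neg.mp hg' with h3 | h3
      · have h4 : u ^ q ^ l = u := by
          rw [← hit]
          exact Function.IsFixedPt.iterate (f := fun z : F => z ^ q) h3 l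
        exact hu (hneg u (h4.symm.trans huQ))
      · have h4 : ∀ n, Even n → u ^ q ^ n = u := by
          rintro n ⟨m, rfl⟩
          rw [← two_mul, ← hit, Function.iterate_mul]
          apply Function.IsFixedPt.iterate
          change (u ^ q) ^ q = u
          rw [h3, hqodd.neg_pow, h3, neg_neg]
        rcases Nat.even_or_odd l with h5 | h5
        · exact hu (hneg u ((h4 l h5).symm.trans huQ))
        · have h6 : Even d := by
            rcases Nat.even_or_odd d with h6 | h6
            · exact h6
            · exact absurd (h5.add_odd h6) (Nat.not_even_iff_odd.mpr hodd)
          exact hu (hneg u ((h4 d h6).symm.trans hud))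
    set v := u ^ q ^ d + u with hvdef
    have hvQ : v ^ q ^ l = -v := by
      rw [hvdef, hadd, huQ, ← pow_mul, mul_comm, pow_mul, huQ, (hodd' d).neg_pow]
      ring
    have hsv : s = y ^ (q ^ d + 1) * v := by
      rw [hs, hvdef]
      ring
    have hy' : y ^ (q ^ d + 1) ≠ 0 := pow_ne_zero _ hy
    have hβ0 : β ≠ 0 := by
      rintro rfl
      exact hβ (IsSquare.zero)
    set c := β * y ^ (q ^ d + 1) with hcdef
    have hc0 : c ≠ 0 := mul_ne_zero hβ0 hy'
    have hcQ : c ^ q ^ l = c := by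
      have h3 : (c - c ^ q ^ l) * v = 0 := by
        rw [hcdef, mul_pow]
        rw [hsv, mul_pow, hvQ] at hT2
        linear_combination hT2
      have := (mul_eq_zero.mp h3).resolve_right hv
      linear_combination -this
    have hcsq : IsSquare c := by
      rw [FiniteField.isSquare_iff (by rw [ringChar.eq F p]; exact hp) hc0, hcard]
      obtain ⟨m, hm⟩ := hodd' l
      have h3 : q ^ l * q ^ l / 2 = (2 * m) * (m + 1) := by
        rw [hm]
        have : (2 * m + 1) * (2 * m + 1) = 2 * (2 * m * (m + 1)) + 1 := by ring
        omega
      have h4 : c ^ (2 * m) = 1 := by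
        rw [hm, pow_succ] at hcQ
        exact (mul_eq_right₀ hc0).mp hcQ
      rw [h3, pow_mul, h4, one_pow]
    have hysq : IsSquare (y ^ (q ^ d + 1)) := ((hodd' d).add_one).isSquare_pow y
    apply hβ
    have : β = c / y ^ (q ^ d + 1) := by
      rw [hcdef]
      field_simp
    rw [this]
    exact hcsq.div hysq

/-!
Every autotopism `(M, N, L)` of the Budaghyan–Helleseth presemifield is shown to be of the form
`M = Ω ∘ S`, `N = Ω⁻¹ ∘ S`, where `Ω` is (a left multiplication by) an element of the middle nucleus
and `S x = u * g x` is a strong autotopism given by a field automorphism `g` and a scalar `u`. Both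
assertions follow: the first is this factorization transported to the semifield
(`IsBHData.exists_strong_up_to_middleNucleus`), and the pairs `(Ω, S)` cover the autotopism group
exactly twice, the ambiguity being a common sign (`IsBHData.two_mul_card_autotopism`).

Write `κ` and `δ` for the powers `q ^ l` and `q ^ d` of Frobenius. The determination of
the autotopisms uses only the few properties of `κ`, `δ`, `β`, `ω` collected in `IsBHData`.

* As `*` is commutative, `Γ = M ∘ N⁻¹` satisfies `Γ x * y = x * Γ y`. Comparing coefficients of
  linearized polynomials shows that such maps are exactly the `x ↦ a x + t b κ(x)` with
  `a, t ∈ 𝔽_q`, where `b` is a fixed solution of `β δ(b) = κ(β b)`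
  (`IsBHData.exists_of_galMul_comm`, `IsBHData.midMap_galMul`). They form a field of order `q ^ 2`,
  since `b κ(b)` is a nonsquare of `𝔽_q` (`IsBHData.mul_self_ne_norm`).
* Conjugation by `N` preserves this field. Composing with a monomial strong autotopism, one may assume
  that `N` has a nonzero linear term; then `N` is `𝔽_q`-linear and commutes with `x ↦ b κ(x)` up to
  a sign. In the eigenbasis of composition with that map, the vanishing of all coefficients
  of `M x * N y` off the few lines on which `L (x * y)` has coefficients becomes a system
  of relations (`IsEigenSystem`) in which only the terms `x` and `κ(x)` can survive
  (`IsEigenSystem.eq_one_or_eq_kappa`). Hence `N` is a middle nucleus element composed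
  with a scalar multiplication (`IsBHData.exists_eq_midMap`).
* It remains to balance `M` against `N`: the middle nucleus element between the two monomials is
  forced to be a scalar of `𝔽_q`, and every element of `𝔽_q` is a square in the field of order
  `q ^ 2` (`IsBHData.exists_factorization`).

For the order, there are `q ^ 2 - 1` choices of `Ω`, and for each of the `2 l h` automorphisms
`x ↦ x ^ p ^ i` the condition on `u` reads
`u ^ ((q ^ d + 1) (q ^ l - 1)) = β ^ ((p ^ i - 1) (q ^ l - 1))`, which has `2 (q ^ l - 1)` solutions
because `gcd(q ^ l + 1, q ^ d + 1) = 2` (`card_isStrongMonomial`).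
-/

/-! ### Linearized polynomials and the coefficients of `L (x * y)` and `M x * N y` -/

section GaloisExpansion

variable {F G : Type*} [Field F] [CommGroup G] [MulSemiringAction G F]

/-- The coefficients of `x ↦ σ • M x`, where `M` has coefficients `c`. -/
def galTwist (σ : G) (c : G → F) (g : G) : F := σ • c (σ⁻¹ * g)

/-- Coefficients of `κ • M x * N y + M x * κ • N y`. -/
def coeffOne (κ : G) (m c : G → F) (g h : G) : F :=
  galTwist κ m g * c h + m g * galTwist κ c h

/-- Coefficients of the trace of `β * (δ • M x * N y + M x * δ • N y)`. -/
def coeffTwo (κ δ : G) (β : F) (m c : G → F) (g h : G) : F :=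
  β * (galTwist δ m g * c h + m g * galTwist δ c h) +
    κ • β * (galTwist κ (galTwist δ m) g * galTwist κ c h +
      galTwist κ m g * galTwist κ (galTwist δ c) h)

theorem galTwist_smul (κ : G) (c : G → F) (g : G) :
    galTwist κ c (κ * g) = κ • c g := by
  simp [galTwist]

theorem galTwist_of_invol {κ : G} (hκ : κ * κ = 1) (c : G → F) (g : G) :
    galTwist κ c g = κ • c (κ * g) := by
  rw [galTwist, inv_eq_of_mul_eq_one_left hκ]

theorem galTwist_comm (κ δ : G) (c : G → F) (g : G) :
    galTwist κ (galTwist δ c) g = galTwist δ (galTwist κ c) g := by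
  simp only [galTwist, ← mul_smul, ← mul_assoc, mul_comm]

theorem galTwist_galTwist {κ : G} (hκ : κ * κ = 1) (c : G → F) (g : G) :
    galTwist κ (galTwist κ c) g = c g := by
  rw [galTwist_of_invol hκ, galTwist_of_invol hκ, ← mul_smul, ← mul_assoc, hκ, one_smul, one_mul]

theorem smul_coeffOne {κ : G} (hκ : κ * κ = 1) (m c : G → F) (g h : G) :
    coeffOne κ m c (κ * g) (κ * h) = κ • coeffOne κ m c g h := by
  have hκκ : ∀ z : F, κ • κ • z = z := fun z => by rw [← mul_smul, hκ, one_smul]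
  simp only [coeffOne, galTwist_smul, smul_add, smul_mul']
  simp only [galTwist_of_invol hκ, hκκ]
  ring

theorem smul_coeffTwo {κ : G} (hκ : κ * κ = 1) (δ : G) (β : F) (m c : G → F) (g h : G) :
    coeffTwo κ δ β m c (κ * g) (κ * h) = κ • coeffTwo κ δ β m c g h := by
  have hκκ : ∀ z : F, κ • κ • z = z := fun z => by rw [← mul_smul, hκ, one_smul]
  simp only [coeffTwo, galTwist_smul, smul_add, smul_mul', galTwist_comm κ δ]
  simp only [← galTwist_comm κ δ, galTwist_smul]
  simp only [galTwist_of_invol hκ, hκκ]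
  ring

section Fintype
variable [Fintype G]

/-- The additive map `x ↦ ∑ g, c g * g • x`: a linearized polynomial, written with the Galois
group as index set instead of powers of Frobenius. -/
def galLin (c : G → F) (x : F) : F := ∑ g, c g * g • x

/-- The biadditive map `(x, y) ↦ ∑ g h, P g h * (g • x * h • y)`. -/
def galBilin (P : G → G → F) (x y : F) : F := ∑ g, ∑ h, P g h * (g • x * h • y)

theorem eq_zero_of_galLin_eq_zero [FaithfulSMul G F] {c : G → F}
    (hc : ∀ x, galLin c x = 0) (g : G) : c g = 0 := by
  have hinj : Function.Injective (fun g : G => ((MulSemiringAction.toRingHom G F g : F →+* F) :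
      F →* F)) := by
    intro g h hgh
    apply FaithfulSMul.eq_of_smul_eq_smul (α := F)
    intro x
    exact DFunLike.congr_fun hgh x
  have hli := (linearIndependent_monoidHom F F).comp _ hinj
  rw [Fintype.linearIndependent_iff] at hli
  apply hli c
  funext x
  have := hc x
  simpa [galLin] using this

theorem galLin_injective [FaithfulSMul G F] {c c' : G → F}
    (h : ∀ x, galLin c x = galLin c' x) (g : G) : c g = c' g := by
  refine sub_eq_zero.mp (eq_zero_of_galLin_eq_zero (c := fun g => c g - c' g) ?_ g)
  intro x
  have := h x
  simp only [galLin, sub_mul, Finset.sum_sub_distrib] at this ⊢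
  rw [this, sub_self]

theorem galBilin_injective [FaithfulSMul G F] {P P' : G → G → F}
    (hP : ∀ x y, galBilin P x y = galBilin P' x y) (g h : G) : P g h = P' g h := by
  have h1 : ∀ y, ∀ g, ∑ h, P g h * h • y = ∑ h, P' g h * h • y := by
    intro y
    refine galLin_injective (c := fun g => ∑ h, P g h * h • y)
      (c' := fun g => ∑ h, P' g h * h • y) ?_
    have key : ∀ (R : G → G → F) (x : F),
        galLin (fun g => ∑ h, R g h * h • y) x = galBilin R x y := by
      intro R x
      simp only [galBilin, galLin, Finset.sum_mul]
      refine Finset.sum_congr rfl fun g _ => Finset.sum_congr rfl fun h _ => ?_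
      ring
    intro x
    rw [key, key, hP]
  exact galLin_injective (c := P g) (c' := P' g) (fun y => h1 y g) h

theorem smul_galLin (σ : G) (c : G → F) (x : F) :
    σ • galLin c x = galLin (galTwist σ c) x := by
  simp only [galLin, galTwist, Finset.smul_sum]
  refine Fintype.sum_equiv (Equiv.mulLeft σ) _ _ ?_
  intro g
  simp [smul_mul', mul_smul]

theorem galLin_mul_galLin (m c : G → F) (x y : F) :
    galLin m x * galLin c y = galBilin (fun g h => m g * c h) x y := by
  simp only [galLin, galBilin, Finset.sum_mul_sum]
  refine Finset.sum_congr rfl fun g _ => Finset.sum_congr rfl fun h _ => ?_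
  ring

theorem galBilin_add (P P' : G → G → F) (x y : F) :
    galBilin P x y + galBilin P' x y = galBilin (fun g h => P g h + P' g h) x y := by
  simp only [galBilin, ← Finset.sum_add_distrib]
  refine Finset.sum_congr rfl fun g _ => Finset.sum_congr rfl fun h _ => ?_
  ring

theorem mul_galBilin (a : F) (P : G → G → F) (x y : F) :
    a * galBilin P x y = galBilin (fun g h => a * P g h) x y := by
  simp only [galBilin, Finset.mul_sum]
  refine Finset.sum_congr rfl fun g _ => Finset.sum_congr rfl fun h _ => ?_
  ring

theorem galBilin_left_graph [DecidableEq G] (σ : G) (f : G → F) (x y : F) :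
    ∑ h, f h * ((h * σ) • x * h • y) =
      galBilin (fun g h => if g = σ * h then f h else 0) x y := by
  unfold galBilin
  rw [Finset.sum_comm]
  refine Finset.sum_congr rfl fun h _ => ?_
  simp [ite_mul, mul_comm h σ]

theorem galBilin_right_graph [DecidableEq G] (σ : G) (f : G → F) (x y : F) :
    ∑ g, f g * (g • x * (g * σ) • y) =
      galBilin (fun g h => if h = σ * g then f g else 0) x y := by
  unfold galBilin
  refine Finset.sum_congr rfl fun h _ => ?_
  simp [ite_mul, mul_comm h σ]

end Fintype

/-- The Budaghyan–Helleseth multiplication, with the powers `q ^ l` and `q ^ d` of Frobenius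
replaced by arbitrary automorphisms `κ` and `δ`. -/
def galMul (κ δ : G) (β ω x y : F) : F :=
  κ • x * y + x * κ • y +
    (β * (δ • x * y + x * δ • y) + κ • (β * (δ • x * y + x * δ • y))) * ω

section Fintype
variable [Fintype G]

theorem galMul_galLin (κ δ : G) (β ω : F) (m c : G → F) (x y : F) :
    galMul κ δ β ω (galLin m x) (galLin c y) =
      galBilin (fun g h => coeffOne κ m c g h + ω * coeffTwo κ δ β m c g h) x y := by
  unfold galMul
  rw [smul_mul' κ β, smul_add, smul_mul' κ (δ • galLin m x), smul_mul' κ (galLin m x)]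
  simp only [smul_galLin, galLin_mul_galLin, galBilin_add, mul_galBilin, mul_comm _ ω]
  rfl

variable [DecidableEq G]

/-- Coefficients of `L (x * y)` for `L = galLin ℓ`. They vanish off the three lines
`g = κ * h`, `g = δ * h` and `h = δ * g`. -/
def coeffMul (κ δ : G) (β ω : F) (ℓ : G → F) (g h : G) : F :=
  (if g = κ * h then ℓ h + ℓ (κ * h) else 0) +
    ((if g = δ * h then h • (β * ω) * (ℓ h - ℓ (κ * h)) else 0) +
      (if h = δ * g then g • (β * ω) * (ℓ g - ℓ (κ * g)) else 0))

theorem galLin_galMul {κ : G} (hκ : κ * κ = 1) (δ : G) (β : F) {ω : F} (hω : κ • ω = -ω)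
    (ℓ : G → F) (x y : F) :
    galLin ℓ (galMul κ δ β ω x y) = galBilin (coeffMul κ δ β ω ℓ) x y := by
  have hκκ : ∀ z : F, κ • κ • z = z := fun z => by rw [← mul_smul, hκ, one_smul]
  have hreindex : ∀ f : G → F, ∑ g, f g = ∑ g, f (κ * g) := fun f =>
    (Fintype.sum_equiv (Equiv.mulLeft κ) _ _ fun g => rfl).symm
  unfold coeffMul
  rw [← galBilin_add, ← galBilin_add, ← galBilin_left_graph, ← galBilin_left_graph,
    ← galBilin_right_graph]
  have h1 : ∑ g, ℓ g * g • (x * κ • y) = ∑ g, ℓ (κ * g) * g • (κ • x * y) := by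
    rw [hreindex]
    refine Finset.sum_congr rfl fun g _ => ?_
    rw [mul_comm κ g, mul_smul, smul_mul', hκκ]
  have h2 : ∑ g, ℓ g * g • (κ • (β * (δ • x * y + x * δ • y)) * ω) =
      - ∑ g, ℓ (κ * g) * g • ((β * (δ • x * y + x * δ • y)) * ω) := by
    rw [hreindex, ← Finset.sum_neg_distrib]
    refine Finset.sum_congr rfl fun g _ => ?_
    rw [mul_comm κ g, mul_smul, smul_mul', hκκ, hω]
    simp [smul_mul']
  have h3 : galLin ℓ (galMul κ δ β ω x y) = ∑ g, ℓ g * g • (κ • x * y) +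
      ∑ g, ℓ g * g • (x * κ • y) + (∑ g, ℓ g * g • ((β * (δ • x * y + x * δ • y)) * ω) +
      ∑ g, ℓ g * g • (κ • (β * (δ • x * y + x * δ • y)) * ω)) := by
    simp only [galLin, galMul, ← Finset.sum_add_distrib]
    refine Finset.sum_congr rfl fun g _ => ?_
    simp only [add_mul, smul_add]
    ring
  rw [h3, h1, h2, ← Finset.sum_neg_distrib]
  simp only [← Finset.sum_add_distrib]
  refine Finset.sum_congr rfl fun g _ => ?_
  simp only [smul_mul', smul_add, mul_smul]
  ring

/-- The coefficients of the two components `P`, `R` of an identity `L (x * y) = P + ω R`, with `P`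
and `R` fixed by `κ`, can be separated. -/
theorem coeff_eq [FaithfulSMul G F] {κ : G} (hκ : κ * κ = 1) {δ : G} {β ω : F} (hω : κ • ω = -ω)
    {ℓ m c : G → F}
    (hL : ∀ x y, galLin ℓ (galMul κ δ β ω x y) = galMul κ δ β ω (galLin m x) (galLin c y))
    (g h : G) :
    coeffMul κ δ β ω ℓ g h = coeffOne κ m c g h + ω * coeffTwo κ δ β m c g h ∧
      coeffMul κ δ β ω ℓ (κ * g) (κ * h) =
        κ • (coeffOne κ m c g h - ω * coeffTwo κ δ β m c g h) := by
  have h1 : ∀ g h, coeffMul κ δ β ω ℓ g h =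
      coeffOne κ m c g h + ω * coeffTwo κ δ β m c g h := by
    refine galBilin_injective fun x y => ?_
    rw [← galLin_galMul hκ δ β hω, hL, galMul_galLin]
  refine ⟨h1 g h, ?_⟩
  rw [h1, smul_coeffOne hκ, smul_coeffTwo hκ, smul_sub, smul_mul', hω]
  ring

/-- Off the three lines on which `x * y` has coefficients, both components of `M x * N y` have
vanishing coefficients. -/
theorem coeff_eq_zero [FaithfulSMul G F] {κ : G} (hκ : κ * κ = 1) {δ : G} {β ω : F}
    (hω : κ • ω = -ω) (hω0 : ω ≠ 0) (h2 : (2 : F) ≠ 0) {ℓ m c : G → F}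
    (hL : ∀ x y, galLin ℓ (galMul κ δ β ω x y) = galMul κ δ β ω (galLin m x) (galLin c y))
    {g h : G} (hg₁ : g ≠ κ * h) (hg₂ : g ≠ δ * h) (hg₃ : h ≠ δ * g) :
    coeffOne κ m c g h = 0 ∧ coeffTwo κ δ β m c g h = 0 := by
  obtain ⟨e1, e2⟩ := coeff_eq hκ hω hL g h
  have z1 : coeffMul κ δ β ω ℓ g h = 0 := by simp [coeffMul, hg₁, hg₂, hg₃]
  have z2 : coeffMul κ δ β ω ℓ (κ * g) (κ * h) = 0 := by
    have h3 : κ * h ≠ δ * (κ * g) := by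
      rw [mul_left_comm]; exact fun h => hg₃ (mul_left_cancel h)
    have h4 : κ * g ≠ δ * (κ * h) := by
      rw [mul_left_comm]; exact fun h => hg₂ (mul_left_cancel h)
    simp [coeffMul, hg₁, h3, h4]
  rw [z1] at e1
  rw [z2] at e2
  have e3 := (smul_eq_zero_iff_eq κ).mp e2.symm
  constructor
  · apply (mul_eq_zero.mp _).resolve_left h2
    linear_combination e3 - e1
  · apply (mul_eq_zero.mp _).resolve_left (mul_ne_zero h2 hω0)
    linear_combination -e3 - e1

end Fintype
end GaloisExpansion

/-! ### The middle nucleus -/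

section MiddleNucleus

variable {F G : Type*} [Field F] [CommGroup G] [MulSemiringAction G F]

/-- The properties of `κ = (x ↦ x ^ q ^ l)`, `δ = (x ↦ x ^ q ^ d)`, `β` and `ω` on which the
determination of the autotopisms rests. The conditions on products of `κ` and `δ` come from `l > 2`,
`gcd(l, d) = 1` and the parity of `l + d`; the elements fixed by `κ` are those of `𝔽_{q ^ l}`, which
are squares in `𝔽_{q ^ {2 l}}`; and `y * δ y = y ^ (q ^ d + 1)` is a square since `q` is odd. -/
structure IsBHData (κ δ : G) (β ω : F) : Prop where
  two_ne_zero : (2 : F) ≠ 0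
  mul_self : κ * κ = 1
  kappa_ne_one : κ ≠ 1
  delta_sq_ne_one : δ * δ ≠ 1
  kappa_delta_ne_one : κ * δ ≠ 1
  kappa_delta_sq_ne_one : κ * (δ * δ) ≠ 1
  kappa_delta_cube_ne_one : κ * (δ * (δ * δ)) ≠ 1
  omega_ne_zero : ω ≠ 0
  smul_omega : κ • ω = -ω
  not_isSquare : ¬ IsSquare β
  isSquare_of_smul_eq : ∀ a : F, κ • a = a → IsSquare a
  isSquare_mul_smul : ∀ y : F, IsSquare (y * δ • y)
  kappa_smul_of_smul_smul : ∀ a : F, κ • δ • a = a → κ • a = a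

/-- The common fixed field of `κ` and `δ`; it plays the role of `𝔽_q`. -/
def biFixed (F : Type*) {G : Type*} [Field F] [CommGroup G] [MulSemiringAction G F] (κ δ : G) :
    Subfield F where
  carrier := {a | κ • a = a ∧ δ • a = a}
  mul_mem' := by rintro a b ⟨h1, h2⟩ ⟨h3, h4⟩; simp [smul_mul', h1, h2, h3, h4]
  one_mem' := by simp
  add_mem' := by rintro a b ⟨h1, h2⟩ ⟨h3, h4⟩; simp [smul_add, h1, h2, h3, h4]
  zero_mem' := by simp
  neg_mem' := by rintro a ⟨h1, h2⟩; simp [h1, h2]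
  inv_mem' := by rintro a ⟨h1, h2⟩; simp [h1, h2]

theorem mem_biFixed {κ δ : G} {a : F} : a ∈ biFixed F κ δ ↔ κ • a = a ∧ δ • a = a := Iff.rfl

/-- The additive map `x ↦ a * x + t * b * κ • x`. For suitable `b`, and `a`, `t` in `𝔽_q`, these
maps describe the middle nucleus. -/
def midMap (κ : G) (b a t x : F) : F := a * x + t * b * κ • x

namespace IsBHData

variable {κ δ : G} {β ω : F} (D : IsBHData κ δ β ω)
include D

theorem smul_smul_self (z : F) : κ • κ • z = z := by rw [← mul_smul, D.mul_self, one_smul]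

theorem eq_zero_of_eq_neg {z : F} (hz : z = -z) : z = 0 := by
  apply (mul_eq_zero.mp _).resolve_left D.two_ne_zero
  linear_combination hz

theorem beta_ne_zero : β ≠ 0 := fun h => D.not_isSquare (h ▸ IsSquare.zero)

theorem smul_beta_ne : κ • β ≠ β := fun h => D.not_isSquare (D.isSquare_of_smul_eq β h)

/-- The two components of `x * y`, in the fixed field of `κ`, can be separated. -/
theorem galMul_eq_galMul_iff (x y x' y' : F) :
    galMul κ δ β ω x y = galMul κ δ β ω x' y' ↔
      κ • x * y + x * κ • y = κ • x' * y' + x' * κ • y' ∧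
      β * (δ • x * y + x * δ • y) + κ • (β * (δ • x * y + x * δ • y)) =
        β * (δ • x' * y' + x' * δ • y') + κ • (β * (δ • x' * y' + x' * δ • y')) := by
  constructor
  · intro h
    have h' := congrArg (κ • ·) h
    simp only [galMul] at h
    simp only [galMul, smul_add κ (_ + _), smul_add κ (_ * _), smul_mul' κ, D.smul_smul_self,
      D.smul_omega] at h'
    simp only [smul_mul' κ, smul_add] at h h' ⊢
    constructor
    · apply mul_left_cancel₀ D.two_ne_zero
      linear_combination h + h'
    · apply mul_left_cancel₀ (mul_ne_zero D.two_ne_zero D.omega_ne_zero)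
      linear_combination h - h'
  · rintro ⟨h1, h2⟩
    rw [galMul, galMul, h1, h2]

/-- The solutions of `β * δ b = κ (β * b)` give elements of the middle nucleus: the corresponding
maps can be moved from one factor of `x * y` to the other. -/
theorem midMap_galMul {b a t : F} (hb : β * δ • b = κ • (β * b))
    (ha : a ∈ biFixed F κ δ) (ht : t ∈ biFixed F κ δ) (x y : F) :
    galMul κ δ β ω (midMap κ b a t x) y = galMul κ δ β ω x (midMap κ b a t y) := by
  obtain ⟨ha1, ha2⟩ := ha
  obtain ⟨ht1, ht2⟩ := ht
  have hκδ : ∀ z : F, δ • κ • z = κ • δ • z := fun z => by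
    rw [← mul_smul, mul_comm, mul_smul]
  have hb' : κ • β * κ • δ • b = β * b := by
    rw [← smul_mul', hb, D.smul_smul_self]
  rw [smul_mul'] at hb
  rw [D.galMul_eq_galMul_iff]
  simp only [midMap, smul_add, smul_mul', hκδ, D.smul_smul_self, ha1, ha2, ht1, ht2]
  constructor
  · ring
  · linear_combination t * (κ • δ • x * y - x * κ • δ • y) * hb +
      t * (δ • x * κ • y - κ • x * δ • y) * hb'

theorem midMap_midMap {b a t a' t' : F} (ha' : a' ∈ biFixed F κ δ)
    (ht' : t' ∈ biFixed F κ δ) (x : F) :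
    midMap κ b a t (midMap κ b a' t' x) =
      midMap κ b (a * a' + t * t' * (b * κ • b)) (a * t' + t * a') x := by
  simp only [midMap, smul_add, smul_mul', D.smul_smul_self, ha'.1, ht'.1]
  ring

theorem norm_mem {b : F} (hb : β * δ • b = κ • (β * b)) : b * κ • b ∈ biFixed F κ δ := by
  have hβ := D.beta_ne_zero
  have hκβ : κ • β ≠ 0 := (smul_ne_zero_iff_ne _).mpr hβ
  constructor
  · rw [smul_mul', D.smul_smul_self, mul_comm]
  · have h1 : κ • β * κ • δ • b = β * b := by
      rw [← smul_mul', hb, D.smul_smul_self]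
    have h3 : δ • κ • b = κ • δ • b := by rw [← mul_smul, mul_comm, mul_smul]
    rw [smul_mul', h3]
    apply mul_left_cancel₀ (mul_ne_zero hβ hκβ)
    rw [smul_mul'] at hb
    linear_combination (κ • β * κ • δ • b) * hb + (κ • β * κ • b) * h1

section Generator

variable {b : F} (hb0 : b ≠ 0) (hb : β * δ • b = κ • (β * b))
include hb0 hb

/-- The norm `b * κ • b` is a nonsquare of `𝔽_q`: writing `b = s * κ y / y` otherwise, the equation
`β * δ b = κ (β * b)` would make `β / (y * δ y)`, hence `β`, a square. -/
theorem mul_self_ne_norm {s : F} (hs : s ∈ biFixed F κ δ) : s * s ≠ b * κ • b := by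
  intro h
  obtain ⟨hs1, hs2⟩ := hs
  have hs0 : s ≠ 0 := by
    rintro rfl
    rw [mul_zero] at h
    rcases mul_eq_zero.mp h.symm with h | h
    · exact hb0 h
    · exact hb0 ((smul_eq_zero_iff_eq κ).mp h)
  obtain ⟨y, hy0, hy⟩ : ∃ y : F, y ≠ 0 ∧ b * y = s * κ • y := by
    by_cases h0 : s + κ • b = 0
    · refine ⟨ω, D.omega_ne_zero, ?_⟩
      have : b = -s := by
        have := congrArg (κ • ·) (eq_neg_of_add_eq_zero_right h0)
        simpa [D.smul_smul_self, hs1] using this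
      rw [D.smul_omega, this]
      ring
    · refine ⟨s + κ • b, h0, ?_⟩
      rw [smul_add, hs1, D.smul_smul_self]
      linear_combination -h
  have hκδ : ∀ z : F, δ • κ • z = κ • δ • z := fun z => by
    rw [← mul_smul, mul_comm, mul_smul]
  set v := y * δ • y with hv
  have hv0 : v ≠ 0 := mul_ne_zero hy0 ((smul_ne_zero_iff_ne δ).mpr hy0)
  have hy' : δ • b * δ • y = s * κ • δ • y := by
    rw [← smul_mul', hy, smul_mul', hs2, hκδ]
  have hy'' : κ • b * κ • y = s * y := by
    rw [← smul_mul', hy, smul_mul', hs1, D.smul_smul_self]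
  have hfix : κ • (β / v) = β / v := by
    have hκv : κ • v ≠ 0 := (smul_ne_zero_iff_ne _).mpr hv0
    rw [smul_div₀', div_eq_div_iff hκv hv0]
    apply mul_left_cancel₀ hs0
    rw [smul_mul'] at hb
    rw [hv, smul_mul']
    linear_combination (δ • y * κ • y) * (-hb) + β * κ • y * hy' - κ • β * δ • y * hy''
  apply D.not_isSquare
  have : β = β / v * v := by field_simp
  rw [this]
  exact (D.isSquare_of_smul_eq _ hfix).mul (D.isSquare_mul_smul y)

/-- The maps `x ↦ a * x + t * b * κ x` form a field: the determinant `a ^ 2 - t ^ 2 * (b * κ b)`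
vanishes only for `a = t = 0`. -/
theorem sq_sub_ne_zero {a t : F} (ha : a ∈ biFixed F κ δ) (ht : t ∈ biFixed F κ δ)
    (hat : a ≠ 0 ∨ t ≠ 0) : a * a - t * t * (b * κ • b) ≠ 0 := by
  intro h
  by_cases ht0 : t = 0
  · subst ht0
    rcases hat with hat | hat
    · apply hat
      simpa using h
    · exact hat rfl
  · apply D.mul_self_ne_norm hb0 hb (div_mem ha ht)
    field_simp
    linear_combination h

end Generator

/-- A linear `Γ` with `Γ x * y = x * Γ y` is one of the maps `x ↦ a x + b' κ x`: comparing the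
coefficients of `g x · κ y` in the first component kills all other terms, and the second component
with `y = 1` gives the conditions on `a` and `b'`. -/
theorem exists_of_galMul_comm [Fintype G] [FaithfulSMul G F] {γ : G → F}
    (hγ : ∀ x y, galMul κ δ β ω (galLin γ x) y = galMul κ δ β ω x (galLin γ y)) :
    ∃ a ∈ biFixed F κ δ, ∃ b' : F, β * δ • b' = κ • (β * b') ∧
      ∀ x, galLin γ x = a * x + b' * κ • x := by
  classical
  have hsupp : ∀ g, g ≠ 1 → g ≠ κ → γ g = 0 := by
    intro g hg1 hgκ
    have hid : ∀ x : F, galLin (fun g : G => if g = 1 then 1 else 0) x = x := by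
      intro x
      simp [galLin]
    set i : G → F := fun g => if g = 1 then 1 else 0 with hi
    have h1 : ∀ x y : F, galBilin (coeffOne κ γ i) x y = galBilin (coeffOne κ i γ) x y := by
      intro x y
      have := ((D.galMul_eq_galMul_iff _ _ _ _).mp (hγ x y)).1
      rw [← hid x, ← hid y] at this
      have e : ∀ m c : G → F, galBilin (coeffOne κ m c) x y =
          κ • galLin m x * galLin c y + galLin m x * κ • galLin c y := by
        intro m c
        simp only [smul_galLin, galLin_mul_galLin, galBilin_add]
        rfl
      rw [e, e]
      simpa only [hid] using this
    have h2 := galBilin_injective h1 g κ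
    have hκ1 := D.kappa_ne_one
    have h3 : κ * g ≠ 1 := fun h => hgκ (by
      rw [← D.mul_self] at h; exact mul_left_cancel h)
    simpa [coeffOne, galTwist_of_invol D.mul_self, hi, hκ1, hg1, D.mul_self, h3] using h2
  have hform : ∀ x, galLin γ x = γ 1 * x + γ κ * κ • x := by
    intro x
    rw [galLin, Fintype.sum_eq_add 1 κ D.kappa_ne_one.symm
      (fun g hg => by rw [hsupp g hg.1 hg.2, zero_mul]), one_smul]
  generalize γ 1 = a at hform
  generalize γ κ = b' at hform
  simp only [hform] at hγ
  have hκδ : ∀ z : F, δ • κ • z = κ • δ • z := fun z => by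
    rw [← mul_smul, mul_comm, mul_smul]
  have ha1 : κ • a = a := by
    have h1 := ((D.galMul_eq_galMul_iff _ _ _ _).mp (hγ ω 1)).1
    simp only [smul_add, smul_mul', smul_one, smul_neg, D.smul_omega] at h1
    have : 2 * ω * (κ • a - a) = 0 := by linear_combination -h1
    exact sub_eq_zero.mp ((mul_eq_zero.mp this).resolve_left
      (mul_ne_zero D.two_ne_zero D.omega_ne_zero))
  set η := β * δ • b' - κ • (β * b') with hη
  set ζ := β * (δ • a - a) with hζ
  have hδκ : δ ≠ κ := fun h => D.kappa_delta_ne_one (by rw [h, D.mul_self])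
  have hδ1 : δ ≠ 1 := fun h => D.delta_sq_ne_one (by rw [h, one_mul])
  have hκδκ : κ * δ ≠ κ := fun h => hδ1 (mul_eq_left.mp h)
  have hκδδ : κ * δ ≠ δ := fun h => D.kappa_ne_one (mul_eq_right.mp h)
  -- the identity `Z + κ Z = 0`, as a relation between the characters `1, κ, δ, κ * δ`
  have hrel : ∀ x : F, galLin (fun g => if g = 1 then -ζ - η else if g = κ then -(κ • ζ) - κ • η
      else if g = δ then ζ + κ • η else if g = κ * δ then κ • ζ + η else 0) x = 0 := by
    intro x
    have e : ∀ f : G → F, galLin f x = ∑ g ∈ {1, κ, δ, κ * δ}, f g * g • x +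
        ∑ g ∈ ({1, κ, δ, κ * δ} : Finset G)ᶜ, f g * g • x := fun f =>
      (Finset.sum_add_sum_compl _ _).symm
    rw [e, Finset.sum_eq_zero (s := ({1, κ, δ, κ * δ} : Finset G)ᶜ), add_zero]
    · rw [Finset.sum_insert, Finset.sum_insert, Finset.sum_insert, Finset.sum_singleton]
      · simp only [if_true, D.kappa_ne_one, hδ1, hδκ, D.kappa_delta_ne_one, hκδκ, hκδδ, if_false]
        have h1 := ((D.galMul_eq_galMul_iff _ _ _ _).mp (hγ x 1)).2
        simp only [smul_add, smul_mul', smul_one, hκδ, D.smul_smul_self, ha1] at h1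
        simp only [hη, hζ, smul_sub, smul_mul', D.smul_smul_self, mul_smul, one_smul, ha1]
        linear_combination h1
      · simp [hκδδ.symm]
      · simp [hδκ.symm, hκδκ.symm]
      · simp [D.kappa_ne_one.symm, hδ1.symm, D.kappa_delta_ne_one.symm]
    · intro g hg
      simp only [Finset.mem_compl, Finset.mem_insert, Finset.mem_singleton, not_or] at hg
      simp [hg.1, hg.2.1, hg.2.2.1, hg.2.2.2]
  have hc := eq_zero_of_galLin_eq_zero hrel
  have c1 : -ζ - η = 0 := by simpa using hc 1
  have c4 : κ • ζ + η = 0 := by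
    simpa [D.kappa_delta_ne_one, hκδκ, hκδδ] using hc (κ * δ)
  have ha2 : δ • a = a := by
    have h1 : κ • ζ = κ • β * (δ • a - a) := by
      rw [hζ, smul_mul', smul_sub, ← hκδ, ha1]
    have h2 : (κ • β - β) * (δ • a - a) = 0 := by
      linear_combination c4 - h1 + c1 + hζ
    exact sub_eq_zero.mp ((mul_eq_zero.mp h2).resolve_left (sub_ne_zero.mpr D.smul_beta_ne))
  refine ⟨a, ⟨ha1, ha2⟩, b', ?_, hform⟩
  have : ζ = 0 := by rw [hζ, ha2, sub_self, mul_zero]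
  apply sub_eq_zero.mp
  linear_combination -c1 - this

/-- The solutions `b'` of `β * δ b' = κ (β * b')` form an `𝔽_q`-line. -/
theorem exists_eq_mul_of_generator {b b' : F} (hb0 : b ≠ 0) (hb : β * δ • b = κ • (β * b))
    (hb' : β * δ • b' = κ • (β * b')) : ∃ t ∈ biFixed F κ δ, b' = t * b := by
  have hβ := D.beta_ne_zero
  have hκβ : κ • β ≠ 0 := (smul_ne_zero_iff_ne _).mpr hβ
  have hδb : δ • b ≠ 0 := (smul_ne_zero_iff_ne _).mpr hb0
  have hκb : κ • b ≠ 0 := (smul_ne_zero_iff_ne _).mpr hb0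
  have h1 : δ • (b' / b) = κ • (b' / b) := by
    rw [smul_div₀', smul_div₀', div_eq_div_iff hδb hκb]
    rw [smul_mul'] at hb hb'
    apply mul_left_cancel₀ (mul_ne_zero hβ hκβ)
    linear_combination (κ • β * κ • b) * hb' - (κ • β * κ • b') * hb
  have h2 : κ • (b' / b) = b' / b :=
    D.kappa_smul_of_smul_smul _ (by rw [h1, D.smul_smul_self])
  exact ⟨b' / b, ⟨h2, h1.trans h2⟩, by field_simp⟩

end IsBHData
end MiddleNucleus

/-! ### The support of a linear component -/

section EigenSystem

variable {F G : Type*} [Field F] [CommGroup G] [MulSemiringAction G F]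

/-- The pair `(g, h)` lies off the lines on which `x * y` has coefficients of `g • x * h • y`. -/
def OffLines (κ δ g h : G) : Prop := g ≠ κ * h ∧ g ≠ δ * h ∧ h ≠ δ * g

/-- The coefficients of an additive map, in the eigenbasis of composition with a generator of
the middle nucleus: `A` and `A'` are its two components, `B` and `B'` those of its image under `δ`.
The relations express that the map is part of an autotopism: those of the first kind, `one`, come
from the component `κ • x * y + x * κ • y` of the multiplication, those of the second kind, `two`,
from the component containing `β`. -/
structure IsEigenSystem (κ δ : G) (r u u' : F) (s A A' B B' : G → F) : Prop where
  r_ne_zero : r ≠ 0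
  u_ne_zero : u ≠ 0
  u'_ne_zero : u' ≠ 0
  s_ne_zero : ∀ g, s g ≠ 0
  shift_A : ∀ g, A (κ * g) * s g = r * A g
  shift_A' : ∀ g, A' (κ * g) * s g = -(r * A' g)
  shift_B : ∀ g, B (κ * g) * s g = r * B g
  shift_B' : ∀ g, B' (κ * g) * s g = -(r * B' g)
  one : ∀ g h, OffLines κ δ g h → u * A g * A h = u' * A' g * A' h
  two : ∀ g h, OffLines κ δ g h →
    u * (A h * B g + B h * A g) + u' * (A' h * B' g + B' h * A' g) = 0
  delta : (∀ g, B (δ * g) = δ • A g ∧ B' (δ * g) = δ • A' g) ∨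
    (∀ g, B (δ * g) = -(δ • A' g) ∧ B' (δ * g) = -(δ • A g))

theorem offLines_mul_right {κ δ g h : G} (j : G) :
    OffLines κ δ (g * j) (h * j) ↔ OffLines κ δ g h := by
  simp only [OffLines, ← mul_assoc, ne_eq, mul_left_inj]

namespace IsBHData

variable {κ δ : G} {β ω : F} (D : IsBHData κ δ β ω)
include D

theorem delta_ne_one : δ ≠ 1 := fun h => D.delta_sq_ne_one (by rw [h, one_mul])

theorem eq_of_kappa_mul_eq {g h : G} (e : κ * g = h) : g = κ * h := by
  rw [← e, ← mul_assoc, D.mul_self, one_mul]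

theorem delta_ne_kappa : δ ≠ κ := fun h => D.kappa_delta_ne_one (by rw [h, D.mul_self])

theorem offLines_self (g : G) : OffLines κ δ g g :=
  ⟨fun h => D.kappa_ne_one (mul_eq_right.mp h.symm), fun h => D.delta_ne_one
    (mul_eq_right.mp h.symm), fun h => D.delta_ne_one (mul_eq_right.mp h.symm)⟩

theorem offLines_kappa_delta (j : G) : OffLines κ δ (κ * (δ * j)) j := by
  have : OffLines κ δ (κ * δ) 1 := by
    refine ⟨fun h => D.delta_ne_one ?_, fun h => D.kappa_ne_one ?_,
      fun h => D.kappa_delta_sq_ne_one ?_⟩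
    · simpa using h
    · simpa using h
    · rw [h, mul_left_comm]
  simpa [mul_assoc] using (offLines_mul_right j).mpr this

theorem offLines_kappa_delta_sq (j : G) : OffLines κ δ (κ * (δ * (δ * j))) j := by
  have : OffLines κ δ (κ * (δ * δ)) 1 := by
    refine ⟨fun h => D.delta_sq_ne_one ?_, fun h => D.kappa_delta_ne_one ?_,
      fun h => D.kappa_delta_cube_ne_one ?_⟩
    · simpa using h
    · rw [← mul_assoc] at h
      simpa using h
    · rw [h, mul_left_comm]
  simpa [mul_assoc] using (offLines_mul_right j).mpr this

theorem offLines_delta_sq (h3 : δ * (δ * δ) ≠ 1) (j : G) : OffLines κ δ (δ * (δ * j)) j := by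
  have : OffLines κ δ (δ * δ) 1 := by
    refine ⟨fun h => D.kappa_delta_sq_ne_one ?_, fun h => D.delta_ne_one ?_, fun h => h3 h.symm⟩
    · rw [h, mul_one, D.mul_self]
    · simpa using h
  simpa [mul_assoc] using (offLines_mul_right j).mpr this

end IsBHData

namespace IsEigenSystem

variable {κ δ : G} {β ω : F} {r u u' : F} {s A A' B B' : G → F}
  (D : IsBHData κ δ β ω) (S : IsEigenSystem κ δ r u u' s A A' B B')
include D S

theorem sq_eq (g : G) : u * A g * A g = u' * A' g * A' g := S.one g g (D.offLines_self g)

theorem A'_ne_zero {g : G} (hg : A g ≠ 0) : A' g ≠ 0 := by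
  intro h
  have := S.sq_eq D g
  rw [h, mul_zero] at this
  exact hg (by simpa [S.u_ne_zero] using this)

theorem A_ne_zero {g : G} (hg : A' g ≠ 0) : A g ≠ 0 := by
  intro h
  have := S.sq_eq D g
  rw [h, mul_zero] at this
  exact hg (by simpa [S.u'_ne_zero] using this.symm)

omit D in
theorem A_kappa_ne_zero {g : G} (hg : A (κ * g) ≠ 0) : A g ≠ 0 := by
  intro h
  have := S.shift_A g
  rw [h, mul_zero] at this
  exact (mul_ne_zero hg (S.s_ne_zero g)) this

omit D in
/-- The relation of the first kind at `(κ * g, h)`: it differs by a sign from that at `(g, h)`. -/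
theorem one_kappa {g h : G} (hgh : OffLines κ δ (κ * g) h) :
    u * A g * A h = -(u' * A' g * A' h) := by
  apply mul_left_cancel₀ S.r_ne_zero
  linear_combination s g * S.one _ _ hgh - u * A h * S.shift_A g + u' * A' h * S.shift_A' g

omit D in
/-- The relation of the second kind at `(κ * g, h)`, which differs by a sign from that at
`(g, h)`. -/
theorem two_kappa {g h : G} (hgh : OffLines κ δ (κ * g) h) :
    u * (A h * B g + B h * A g) = u' * (A' h * B' g + B' h * A' g) := by
  apply mul_left_cancel₀ S.r_ne_zero
  linear_combination s g * S.two _ _ hgh - u * (A h * S.shift_B g + B h * S.shift_A g) -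
    u' * (A' h * S.shift_B' g + B' h * S.shift_A' g)

/-- When `(g, h)` and `(κ * g, h)` are both off the lines, the two relations of the first kind, which
have opposite signs, force one of the coefficients to vanish. -/
theorem mul_eq_zero_of_offLines {g h : G} (h1 : OffLines κ δ g h) (h2 : OffLines κ δ (κ * g) h) :
    A g * A h = 0 := by
  apply (mul_eq_zero.mp _).resolve_left (mul_ne_zero D.two_ne_zero S.u_ne_zero)
  linear_combination S.one _ _ h1 + S.one_kappa h2

/-- The support does not contain all of `j`, `δ * j` and `δ * (δ * j)`. -/
theorem A_delta_sq_eq_zero {j : G} (h0 : A j ≠ 0) (h1 : A (δ * j) ≠ 0) :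
    A (δ * (δ * j)) = 0 := by
  by_cases h3 : δ * (δ * δ) = 1
  · -- the ratios `A' / A` at `j`, `δ j`, `δ ^ 2 j` would be pairwise opposite
    by_contra h2
    have e1 := S.one_kappa (D.offLines_kappa_delta j)
    have e2 := S.one_kappa (D.offLines_kappa_delta (δ * j))
    have e3 := S.one_kappa (D.offLines_kappa_delta (δ * (δ * j)))
    have hj : δ * (δ * (δ * j)) = j := by
      have : δ * (δ * (δ * j)) = (δ * (δ * δ)) * j := by simp [mul_assoc]
      rw [this, h3, one_mul]
    rw [hj] at e3
    have e4 := S.sq_eq D (δ * j)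
    have hne := mul_ne_zero (mul_ne_zero D.two_ne_zero (mul_ne_zero S.u_ne_zero S.u_ne_zero))
      (mul_ne_zero (mul_ne_zero h0 h2) (mul_ne_zero h1 h1))
    apply hne
    linear_combination (u * A (δ * (δ * j)) * A (δ * j)) * e1 - u' * A' (δ * j) * A' j * e2 +
      u * A (δ * j) * A (δ * j) * e3 -
        (u' * A' j * A' (δ * (δ * j))) * e4
  · have := S.mul_eq_zero_of_offLines D (D.offLines_delta_sq h3 j) (D.offLines_kappa_delta_sq j)
    exact (mul_eq_zero.mp this).resolve_right h0

/-- The support does not contain both `j` and `δ * j`. By the relations of the first kind, the ratios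
`A' / A` at `j` and `δ * j` are opposite; together with those of the second kind, they also make
the images of these ratios under `δ` equal. -/
theorem A_delta_eq_zero {j : G} (h0 : A j ≠ 0) : A (δ * j) = 0 := by
  by_contra h1
  have hz := S.A_delta_sq_eq_zero D h0 h1
  have hz' : A' (δ * (δ * j)) = 0 := by
    by_contra h
    exact S.A_ne_zero D h hz
  have h0' := S.A'_ne_zero D h0
  have h1' := S.A'_ne_zero D h1
  have i1 := S.sq_eq D j
  have i2 := S.one_kappa (D.offLines_kappa_delta j)
  have i3 := S.two _ _ (D.offLines_self (δ * j))
  have i4 := S.two_kappa (D.offLines_kappa_delta_sq j)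
  rw [hz, hz', mul_zero, mul_zero, add_zero, add_zero] at i4
  have hu := S.u_ne_zero
  have k1 : A j * A' (δ * j) = -(A' j * A (δ * j)) := by
    apply mul_left_cancel₀ (mul_ne_zero hu h0)
    linear_combination A' (δ * j) * i1 + A' j * i2
  have k2 : δ • A j * δ • A' (δ * j) = -(δ • A' j * δ • A (δ * j)) := by
    rw [← smul_mul', ← smul_mul', ← smul_neg, k1]
  have i3' : u * A (δ * j) * B (δ * j) = -(u' * A' (δ * j) * B' (δ * j)) := by
    apply mul_left_cancel₀ D.two_ne_zero
    linear_combination i3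
  have key : δ • A j * δ • A' (δ * j) = δ • A' j * δ • A (δ * j) := by
    rcases S.delta with hB | hB
    · rw [(hB j).1, (hB j).2] at i3'
      rw [(hB _).1, (hB _).2] at i4
      have k3 : A' j * δ • A j = A j * δ • A' j := by
        apply mul_left_cancel₀ (mul_ne_zero hu h1)
        linear_combination A' j * i3' - δ • A' j * i2
      have k4 : A' j * δ • A (δ * j) = A j * δ • A' (δ * j) := by
        apply mul_left_cancel₀ (mul_ne_zero hu h0)
        linear_combination A' j * i4 - δ • A' (δ * j) * i1
      apply mul_left_cancel₀ (mul_ne_zero h0 h0')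
      linear_combination (A j * δ • A' (δ * j)) * k3 - (A j * δ • A' j) * k4
    · rw [(hB j).1, (hB j).2] at i3'
      rw [(hB _).1, (hB _).2] at i4
      have k3 : A' j * δ • A' j = A j * δ • A j := by
        apply mul_left_cancel₀ (mul_ne_zero hu h1)
        linear_combination -A' j * i3' - δ • A j * i2
      have k4 : A' j * δ • A' (δ * j) = A j * δ • A (δ * j) := by
        apply mul_left_cancel₀ (mul_ne_zero hu h0)
        linear_combination -A' j * i4 - δ • A (δ * j) * i1
      apply mul_left_cancel₀ (mul_ne_zero h0 h0')
      linear_combination -(A' j * δ • A' (δ * j)) * k3 + (A' j * δ • A' j) * k4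
  have hne : 2 * (δ • A' j * δ • A (δ * j)) ≠ 0 :=
    mul_ne_zero D.two_ne_zero (mul_ne_zero ((smul_ne_zero_iff_ne δ).mpr h0')
      ((smul_ne_zero_iff_ne δ).mpr h1))
  apply hne
  linear_combination k2 - key

/-- The additive map has only two terms, which differ by `κ`. -/
theorem eq_one_or_eq_kappa {i : G} (h1 : A 1 ≠ 0) (hi : A i ≠ 0) : i = 1 ∨ i = κ := by
  by_contra! hne
  have hoff : ¬ (i = δ ∨ i = κ * δ ∨ δ * i = 1 ∨ κ * (δ * i) = 1) := by
    rintro (h | h | h | h)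
    · have := S.A_delta_eq_zero D h1
      rw [mul_one, ← h] at this
      exact hi this
    · rw [h] at hi
      have := S.A_delta_eq_zero D h1
      rw [mul_one] at this
      exact S.A_kappa_ne_zero hi this
    · have := S.A_delta_eq_zero D hi
      rw [h] at this
      exact h1 this
    · have := S.A_delta_eq_zero D hi
      rw [← h] at h1
      exact S.A_kappa_ne_zero h1 this
  push Not at hoff
  obtain ⟨o1, o2, o3, o4⟩ := hoff
  have hz := S.mul_eq_zero_of_offLines D (g := i) (h := 1) ?_ ?_
  · exact (mul_ne_zero hi h1) hz
  · exact ⟨by simpa using hne.2, by simpa using o1, fun h => o3 h.symm⟩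
  · refine ⟨?_, ?_, ?_⟩
    · simpa using hne.1
    · intro h
      rw [mul_one] at h
      exact o2 (D.eq_of_kappa_mul_eq h)
    · intro h
      exact o4 (by rw [mul_left_comm]; exact h.symm)

/-- The ratio `A' / A` at `1` agrees with `B' / B` at `δ`, its image (or the inverse of its image)
under `δ`. -/
theorem A_delta_one (h1 : A 1 ≠ 0) : A' 1 * B δ = A 1 * B' δ := by
  have z := S.A_delta_eq_zero D h1
  rw [mul_one] at z
  have z' : A' δ = 0 := by
    by_contra h
    exact S.A_ne_zero D h z
  have e := S.two_kappa (g := δ) (h := 1) (by simpa using D.offLines_kappa_delta 1)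
  rw [z, z', mul_zero, mul_zero, add_zero, add_zero] at e
  have i1 := S.sq_eq D 1
  apply mul_left_cancel₀ (mul_ne_zero S.u_ne_zero h1)
  linear_combination A' 1 * e - B' δ * i1

end IsEigenSystem
end EigenSystem

/-! ### Coefficients in the eigenbasis of the middle nucleus -/

section Normalized

variable {F G : Type*} [Field F] [CommGroup G] [MulSemiringAction G F]

namespace IsBHData

variable {κ δ : G} {β ω : F} (D : IsBHData κ δ β ω)
include D

/-- The first component of `Ω (N x) * N y`, where `Ω` is a middle nucleus element, in terms of the
coefficients `c g` of `N` and `C g = ε * b * galTwist κ c g`. -/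
theorem coeffOne_mid {b a t ε : F} (ha : a ∈ biFixed F κ δ) (ht : t ∈ biFixed F κ δ)
    (hε : ε * ε = 1) (c : G → F) (g h : G) :
    b * coeffOne κ (fun g => a * c g + t * b * galTwist κ c g) c g h =
      t * (b * κ • b) * c g * c h +
        a * ε * ((ε * b * galTwist κ c g) * c h + c g * (ε * b * galTwist κ c h)) +
        t * (ε * b * galTwist κ c g) * (ε * b * galTwist κ c h) := by
  have h1 : galTwist κ (fun g => a * c g + t * b * galTwist κ c g) g =
      a * galTwist κ c g + t * κ • b * c g := by
    have := galTwist_galTwist D.mul_self c g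
    rw [galTwist] at this
    rw [galTwist, smul_add, smul_mul', smul_mul', smul_mul', ha.1, ht.1, this, galTwist]
  rw [coeffOne, h1]
  linear_combination -(a * b * (galTwist κ c g * c h + c g * galTwist κ c h) +
    t * b * b * galTwist κ c g * galTwist κ c h) * hε

/-- The second component of `Ω (N x) * N y`, in terms of `c` and `C`. -/
theorem coeffTwo_mid {b a t ε : F} (hb : β * δ • b = κ • (β * b)) (ha : a ∈ biFixed F κ δ)
    (ht : t ∈ biFixed F κ δ) (hε : ε * ε = 1) (hεE : ε ∈ biFixed F κ δ) {c C : G → F}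
    (hC : ∀ g, C g = ε * b * galTwist κ c g) (g h : G) :
    b * κ • b * coeffTwo κ δ β (fun g => a * c g + t * b * galTwist κ c g) c g h =
      β * (a * (b * κ • b) * (galTwist δ c g * c h + c g * galTwist δ c h) +
        a * (galTwist δ C g * C h + C g * galTwist δ C h) +
        t * ε * (b * κ • b) * (galTwist δ C g * c h + C g * galTwist δ c h +
          galTwist δ c g * C h + c g * galTwist δ C h)) := by
  have hm : ∀ g, (fun g => a * c g + t * b * galTwist κ c g) g = a * c g + t * ε * C g := by
    intro g
    rw [hC]
    linear_combination -(t * b * galTwist κ c g) * hε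
  have h1 : ∀ g, galTwist κ (fun g => a * c g + t * b * galTwist κ c g) g =
      a * galTwist κ c g + t * κ • b * c g := by
    intro g
    have := galTwist_galTwist D.mul_self c g
    rw [galTwist] at this
    rw [galTwist, smul_add, smul_mul', smul_mul', smul_mul', ha.1, ht.1, this, galTwist]
  have h2 : ∀ g, galTwist δ (fun g => a * c g + t * b * galTwist κ c g) g =
      a * galTwist δ c g + t * ε * galTwist δ C g := by
    intro g
    have := hm (δ⁻¹ * g)
    beta_reduce at this
    rw [galTwist, this, smul_add, smul_mul', smul_mul', smul_mul', ha.2, ht.2, hεE.2]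
    rfl
  have h3 : ∀ g, galTwist δ C g = ε * δ • b * galTwist δ (galTwist κ c) g := by
    intro g
    rw [galTwist, hC, smul_mul', smul_mul', hεE.2]
    rfl
  have h4 : ∀ g, galTwist κ (galTwist δ (fun g => a * c g + t * b * galTwist κ c g)) g =
      a * galTwist δ (galTwist κ c) g + t * δ • κ • b * galTwist δ c g := by
    intro g
    rw [galTwist_comm, galTwist, h1, smul_add, smul_mul', smul_mul', smul_mul', ha.2, ht.2]
    rfl
  have hb' : κ • β * δ • κ • b = β * b := by
    have : δ • κ • b = κ • δ • b := by rw [← mul_smul, mul_comm, mul_smul]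
    rw [this, ← smul_mul', hb, D.smul_smul_self]
  rw [coeffTwo, h4, h2, galTwist_comm κ δ c, h1, h3, h3, hC, hC]
  rw [smul_mul'] at hb
  set x := galTwist κ c g
  set y := galTwist κ c h
  set X := galTwist δ (galTwist κ c) g
  set Y := galTwist δ (galTwist κ c) h
  linear_combination (-a * b * (X * y + x * Y) - t * (b * κ • b) * c g * Y) * hb +
    t * (b * κ • b) * galTwist δ c g * y * hb' -
    β * (a * δ • b * b * (X * y + x * Y) + t * (b * κ • b) * (b * x * galTwist δ c h +
      b * galTwist δ c g * y + δ • b * c g * Y)) * hε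

/-- The coefficients of the second map of an autotopism which is linear over `𝔽_q` and commutes
up to a sign `ε` with a generator of the middle nucleus form an eigensystem: composition with the
generator exchanges `c` and `C` up to the factor `b * κ b = r ^ 2`, so that `r * c ± C` are
eigenvectors, and in these coordinates the two components contain no mixed products. -/
theorem isEigenSystem {b a t ε r : F} (hb0 : b ≠ 0) (hb : β * δ • b = κ • (β * b))
    (ha : a ∈ biFixed F κ δ) (ht : t ∈ biFixed F κ δ) (hat : a ≠ 0 ∨ t ≠ 0)
    (hε : ε * ε = 1) (hεE : ε ∈ biFixed F κ δ) (hr : r * r = b * κ • b) {c C : G → F}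
    (hC : ∀ g, C g = ε * b * galTwist κ c g) (hcb : ∀ g, c g * g • b = ε * b * κ • c g)
    (hce : ∀ g, c g * g • (b * κ • b) = c g * (b * κ • b))
    (hoff : ∀ g h, OffLines κ δ g h →
      coeffOne κ (fun g => a * c g + t * b * galTwist κ c g) c g h = 0 ∧
        coeffTwo κ δ β (fun g => a * c g + t * b * galTwist κ c g) c g h = 0) :
    IsEigenSystem κ δ r (a * ε + t * r) (a * ε - t * r) (fun g => (κ * g) • b)
      (fun g => r * c g + C g) (fun g => r * c g - C g)
      (fun g => r * galTwist δ c g + galTwist δ C g)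
      (fun g => r * galTwist δ c g - galTwist δ C g) := by
  have hκb0 : κ • b ≠ 0 := (smul_ne_zero_iff_ne κ).mpr hb0
  have he0 : b * κ • b ≠ 0 := mul_ne_zero hb0 hκb0
  have hr0 : r ≠ 0 := by
    rintro rfl
    rw [mul_zero] at hr
    exact he0 hr.symm
  have hprod : (a * ε + t * r) * (a * ε - t * r) ≠ 0 := by
    have := D.sq_sub_ne_zero hb0 hb ha ht hat
    contrapose! this
    linear_combination this - a * a * hε + t * t * hr
  have shift_c : ∀ g, c (κ * g) * (κ * g) • b = C g := by
    intro g
    rw [hcb, hC, galTwist_of_invol D.mul_self]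
  have shift_C : ∀ g, C (κ * g) * (κ * g) • b = b * κ • b * c g := by
    intro g
    rw [hC, galTwist_smul, ← hcb, mul_assoc, mul_comm κ g, mul_smul, ← smul_mul', hce, mul_comm]
  have shift_δc : ∀ g, galTwist δ c (κ * g) * (κ * g) • b = galTwist δ C g := by
    intro g
    simp only [galTwist]
    rw [← shift_c, smul_mul', ← mul_smul]
    simp [mul_left_comm]
  have shift_δC : ∀ g, galTwist δ C (κ * g) * (κ * g) • b = b * κ • b * galTwist δ c g := by
    intro g
    simp only [galTwist]
    have := congrArg (δ • ·) (shift_C (δ⁻¹ * g))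
    simp only [smul_mul' δ] at this
    rw [← mul_smul, ← smul_mul' δ b, (D.norm_mem hb).2] at this
    rw [← this]
    simp [mul_left_comm]
  refine ⟨hr0, left_ne_zero_of_mul hprod, right_ne_zero_of_mul hprod,
    fun g => (smul_ne_zero_iff_ne _).mpr hb0, ?_, ?_, ?_, ?_, ?_, ?_, ?_⟩
  · intro g
    linear_combination r * shift_c g + shift_C g - c g * hr
  · intro g
    linear_combination r * shift_c g - shift_C g + c g * hr
  · intro g
    linear_combination r * shift_δc g + shift_δC g - galTwist δ c g * hr
  · intro g
    linear_combination r * shift_δc g - shift_δC g + galTwist δ c g * hr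
  · intro g h hgh
    have h1 := D.coeffOne_mid (b := b) ha ht hε c g h
    rw [(hoff g h hgh).1, mul_zero, ← hC, ← hC] at h1
    linear_combination -2 * r * h1 + 2 * t * r * c g * c h * hr
  · intro g h hgh
    have h1 := D.coeffTwo_mid hb ha ht hε hεE hC g h
    rw [(hoff g h hgh).2, mul_zero, eq_comm, mul_eq_zero] at h1
    have h1 := h1.resolve_left D.beta_ne_zero
    set S₁ := galTwist δ c g * c h + c g * galTwist δ c h with hS₁
    set S₃ := galTwist δ C g * c h + C g * galTwist δ c h +
          galTwist δ c g * C h + c g * galTwist δ C h with hS₃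
    linear_combination 2 * ε * h1 + (2 * a * ε * S₁ + 2 * t * S₃) * hr -
      2 * t * (b * κ • b) * S₃ * hε
  · have h1 : (δ • r - r) * (δ • r + r) = 0 := by
      have := (D.norm_mem hb).2
      rw [← hr, smul_mul'] at this
      linear_combination this
    rcases mul_eq_zero.mp h1 with h1 | h1
    · left
      intro g
      rw [sub_eq_zero] at h1
      simp only [galTwist_smul, smul_add, smul_sub, smul_mul', h1, and_self]
    · right
      intro g
      have h1 := eq_neg_of_add_eq_zero_left h1
      simp only [galTwist_smul, smul_add, smul_sub, smul_mul', h1]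
      constructor <;> ring

end IsBHData
end Normalized

/-! ### Components with a nonzero linear term -/

section Normalized

variable {F G : Type*} [Field F] [CommGroup G] [MulSemiringAction G F] [Fintype G]

theorem midMap_galLin {κ : G} (b a t : F) (c : G → F) (x : F) :
    midMap κ b a t (galLin c x) = galLin (fun g => a * c g + t * b * galTwist κ c g) x := by
  rw [midMap, smul_galLin]
  simp only [galLin, Finset.mul_sum, ← Finset.sum_add_distrib]
  refine Finset.sum_congr rfl fun g _ => ?_
  ring

namespace IsBHData

variable {κ δ : G} {β ω : F} (D : IsBHData κ δ β ω)
include D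

theorem galLin_midMap (b a t : F) (c : G → F) (x : F) :
    galLin c (midMap κ b a t x) =
      galLin (fun g => c g * g • a + c (κ * g) * (κ * g) • (t * b)) x := by
  have h1 : ∑ g, c (κ * g) * (κ * g) • (t * b) * g • x = ∑ g, c g * g • (t * b * κ • x) := by
    refine Fintype.sum_equiv (Equiv.mulLeft κ) _ _ fun g => ?_
    simp only [Equiv.coe_mulLeft, smul_mul' (κ * g)]
    rw [mul_comm κ g, mul_smul g κ (κ • x), D.smul_smul_self]
    ring
  simp only [galLin, midMap, add_mul, Finset.sum_add_distrib, smul_add, mul_add]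
  rw [h1]
  congr 1
  refine Finset.sum_congr rfl fun g _ => ?_
  rw [smul_mul']
  ring

/-- The two terms of `N`, at `1` and `κ`, are in a ratio which makes `N` a middle nucleus element
composed with multiplication by `c 1`. -/
theorem exists_eq_midMap_of_isEigenSystem {b ε r u u' : F} {s : G → F} (hb0 : b ≠ 0)
    (hb : β * δ • b = κ • (β * b)) (hε : ε * ε = 1) (hεE : ε ∈ biFixed F κ δ) (hr0 : r ≠ 0)
    {c C : G → F}
    (hC : ∀ g, C g = ε * b * galTwist κ c g) (hcb : ∀ g, c g * g • b = ε * b * κ • c g)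
    (S : IsEigenSystem κ δ r u u' s (fun g => r * c g + C g) (fun g => r * c g - C g)
      (fun g => r * galTwist δ c g + galTwist δ C g)
      (fun g => r * galTwist δ c g - galTwist δ C g)) (hc1 : c 1 ≠ 0) :
    ∃ t ∈ biFixed F κ δ, ∀ x, galLin c x = midMap κ b 1 t (c 1 * x) := by
  have hA : ∀ g, c g ≠ 0 → r * c g + C g ≠ 0 := by
    intro g hg h
    by_cases h' : r * c g - C g = 0
    · exact mul_ne_zero D.two_ne_zero (mul_ne_zero hr0 hg) (by linear_combination h + h')
    · exact S.A_ne_zero D h' h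
  have hsupp : ∀ g, g ≠ 1 → g ≠ κ → c g = 0 := by
    intro g h1 h2
    by_contra h
    rcases S.eq_one_or_eq_kappa D (hA 1 hc1) (hA g h) with h | h
    · exact h1 h
    · exact h2 h
  have hform : ∀ x, galLin c x = c 1 * x + c κ * κ • x := by
    intro x
    classical
    rw [galLin, Fintype.sum_eq_add 1 κ D.kappa_ne_one.symm
      (fun g hg => by rw [hsupp g hg.1 hg.2, zero_mul]), one_smul]
  have hκ1 : κ • c 1 = ε * c 1 := by
    have := hcb 1
    rw [one_smul] at this
    apply mul_left_cancel₀ hb0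
    linear_combination -ε * this - b * κ • c 1 * hε
  have hC1 : C 1 = c κ * κ • b := by
    rw [hC, hcb, galTwist_of_invol D.mul_self, mul_one]
  have hκC : κ • C 1 = ε * C 1 := by
    rw [hC1, smul_mul', D.smul_smul_self]
    have := hcb κ
    apply mul_left_cancel₀ (mul_self_ne_zero.mp (hε ▸ one_ne_zero) : ε ≠ 0)
    linear_combination -this - c κ * κ • b * hε
  have hδC : c 1 * δ • C 1 = C 1 * δ • c 1 := by
    have := S.A_delta_one D (hA 1 hc1)
    have e1 : ∀ f : G → F, galTwist δ f δ = δ • f 1 := fun f => by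
      rw [galTwist, inv_mul_cancel]
    simp only [e1] at this
    apply mul_left_cancel₀ (mul_ne_zero D.two_ne_zero hr0)
    linear_combination this
  have hδ0 : δ • c 1 ≠ 0 := (smul_ne_zero_iff_ne δ).mpr hc1
  have hε0 : ε ≠ 0 := mul_self_ne_zero.mp (hε ▸ one_ne_zero)
  have hτ : C 1 / c 1 ∈ biFixed F κ δ := by
    constructor
    · rw [smul_div₀', hκC, hκ1, mul_div_mul_left _ _ hε0]
    · rw [smul_div₀', div_eq_div_iff hδ0 hc1]
      linear_combination hδC
  refine ⟨C 1 / c 1 * ε / (b * κ • b), div_mem (mul_mem hτ hεE) (D.norm_mem hb), fun x => ?_⟩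
  have hκb0 : κ • b ≠ 0 := (smul_ne_zero_iff_ne κ).mpr hb0
  rw [hform, midMap, smul_mul', hκ1, hC1]
  field_simp
  linear_combination -c κ * κ • x * hε

/-- The second component `N` of an autotopism `(Ω ∘ N, N, L)` with a nonzero linear term is a middle
nucleus element composed with a scalar multiplication. Since conjugation by `N` preserves the middle
nucleus (`hmid`), a field of order `q ^ 2`, the map `N` is semilinear over it; the linear term forces
linearity over `𝔽_q`, and compatibility up to sign with the generator. -/
theorem exists_eq_midMap [FaithfulSMul G F] {b a t : F} (hb0 : b ≠ 0)
    (hb : β * δ • b = κ • (β * b))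
    (ha : a ∈ biFixed F κ δ) (ht : t ∈ biFixed F κ δ) (hat : a ≠ 0 ∨ t ≠ 0) {ℓ c : G → F}
    (hc1 : c 1 ≠ 0)
    (hinj : Function.Injective (galLin c))
    (hL : ∀ x y, galLin ℓ (galMul κ δ β ω x y) =
      galMul κ δ β ω (midMap κ b a t (galLin c x)) (galLin c y))
    (hmid : ∀ a ∈ biFixed F κ δ, ∀ t ∈ biFixed F κ δ, ∃ a' ∈ biFixed F κ δ,
      ∃ t' ∈ biFixed F κ δ, ∀ x, midMap κ b a t (galLin c x) = galLin c (midMap κ b a' t' x)) :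
    ∃ t ∈ biFixed F κ δ, ∀ x, galLin c x = midMap κ b 1 t (c 1 * x) := by
  classical
  have hκb0 : κ • b ≠ 0 := (smul_ne_zero_iff_ne κ).mpr hb0
  have he0 : b * κ • b ≠ 0 := mul_ne_zero hb0 hκb0
  -- comparison of coefficients in `Δ ∘ N = N ∘ Δ'`
  have hcoef : ∀ a t a' t' : F,
      (∀ x, midMap κ b a t (galLin c x) = galLin c (midMap κ b a' t' x)) → ∀ g,
      a * c g + t * b * κ • c (κ * g) = c g * g • a' + c (κ * g) * (κ * g) • (t' * b) := by
    intro a t a' t' h g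
    have := galLin_injective (fun x => ((midMap_galLin b a t c x).symm.trans (h x)).trans
      (D.galLin_midMap b a' t' c x)) g
    rw [← galTwist_of_invol D.mul_self]
    exact this
  -- `N` is linear over `𝔽_q`
  have hlin : ∀ a ∈ biFixed F κ δ, ∀ g, c g * g • a = a * c g := by
    intro a ha
    obtain ⟨a', ha', t', ht', h⟩ := hmid a ha 0 (zero_mem _)
    have h1 := hcoef _ _ _ _ h
    simp only [zero_mul, add_zero] at h1
    have ht0 : t' = 0 := by
      by_contra ht0
      have h2 := h1 1
      have h3 := h1 κ
      rw [D.mul_self] at h3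
      simp only [mul_one, one_smul] at h2 h3
      rw [ha'.1] at h3
      have h4 : (a - a') * (a - a') = t' * t' * (b * κ • b) := by
        rw [smul_mul', ht'.1] at h2
        apply mul_left_cancel₀ hc1
        linear_combination (a - a') * h2 + (t' * κ • b) * h3
      apply D.mul_self_ne_norm hb0 hb (div_mem (sub_mem ha ha') ht')
      field_simp
      linear_combination h4
    subst ht0
    simp only [zero_mul, smul_zero, mul_zero, add_zero] at h1
    have h5 : a = a' := by
      have := h1 1
      rw [one_smul, mul_comm] at this
      exact mul_left_cancel₀ hc1 this
    subst h5
    exact fun g => (h1 g).symm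
  -- a generator of the middle nucleus commutes with `N` up to a sign
  obtain ⟨ε', hε', ε, hεE, h⟩ := hmid 0 (zero_mem _) 1 (one_mem _)
  have h1 := hcoef _ _ _ _ h
  have hsq : ε' * ε' + ε * ε * (b * κ • b) = b * κ • b ∧ ε * ε' = 0 := by
    have hN : ∀ x, galLin c (b * κ • b * x) = b * κ • b * galLin c x := by
      intro x
      simp only [galLin, Finset.mul_sum, smul_mul' _ (b * κ • b)]
      refine Finset.sum_congr rfl fun g _ => ?_
      linear_combination g • x * hlin _ (D.norm_mem hb) g
    have h4 : ∀ x, midMap κ b (ε' * ε' + ε * ε * (b * κ • b)) (ε' * ε + ε * ε') x =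
        b * κ • b * x := by
      intro x
      apply hinj
      rw [← D.midMap_midMap hε' hεE, ← h, ← h, D.midMap_midMap (zero_mem _) (one_mem _), hN]
      simp [midMap]
    have h5 := h4 1
    have h6 := h4 ω
    simp only [midMap, smul_one, D.smul_omega] at h5 h6
    constructor
    · apply mul_left_cancel₀ (mul_ne_zero D.two_ne_zero D.omega_ne_zero)
      linear_combination h6 + ω * h5
    · apply mul_left_cancel₀ (mul_ne_zero (mul_ne_zero D.two_ne_zero D.two_ne_zero)
        (mul_ne_zero D.omega_ne_zero hb0))
      linear_combination ω * h5 - h6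
  have hε'0 : ε' = 0 := by
    rcases mul_eq_zero.mp hsq.2 with h | h
    · exfalso
      apply D.mul_self_ne_norm hb0 hb hε'
      have := hsq.1
      rw [h] at this
      linear_combination this
    · exact h
  have hεε : ε * ε = 1 := by
    have := hsq.1
    rw [hε'0] at this
    apply mul_right_cancel₀ he0
    linear_combination this
  have hcb : ∀ g, c g * g • b = ε * b * κ • c g := by
    intro g
    have h4 := h1 (κ * g)
    simp only [← mul_assoc, D.mul_self, one_mul, hε'0, smul_zero, mul_zero, smul_mul',
      hlin _ hεE, zero_mul, zero_add] at h4
    linear_combination -ε * h4 - c g * g • b * hεε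
  obtain ⟨r, hr⟩ := D.isSquare_of_smul_eq _ (D.norm_mem hb).1
  have hr0 : r ≠ 0 := by
    rintro rfl
    exact he0 (by rw [hr, mul_zero])
  refine D.exists_eq_midMap_of_isEigenSystem hb0 hb hεε hεE hr0 (fun _ => rfl) hcb
    (D.isEigenSystem hb0 hb ha ht hat hεε hεE hr.symm (fun _ => rfl) hcb ?_ ?_) hc1
  · intro g
    rw [hlin _ (D.norm_mem hb), mul_comm]
  · intro g h hgh
    refine coeff_eq_zero D.mul_self D.smul_omega D.omega_ne_zero D.two_ne_zero (ℓ := ℓ)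
      (fun x y => ?_) hgh.1 hgh.2.1 hgh.2.2
    rw [hL, midMap_galLin]

end IsBHData
end Normalized

/-! ### Monomial strong autotopisms and conjugation of the middle nucleus -/

section Classification

theorem IsPresemifield.surjective_mul_right {F : Type*} [AddCommGroup F] [Finite F]
    {mul : F → F → F} (hmul : IsPresemifield mul) {e : F} (he : e ≠ 0) :
    Function.Surjective (fun x => mul x e) := by
  apply Finite.surjective_of_injective
  intro a b hab
  have h2 : mul (a - b) e = 0 := by
    have h3 := hmul.add_mul (a - b) b e
    rw [sub_add_cancel] at h3
    have h4 : mul a e = mul b e := hab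
    rw [h4] at h3
    exact right_eq_add.mp h3
  exact sub_eq_zero.mp ((hmul.eq_zero_or_eq_zero _ _ h2).resolve_right he)

variable {F G : Type*} [Field F] [CommGroup G] [MulSemiringAction G F]

/-- The condition on `u` for `x ↦ u * g • x` to be a strong autotopism: `β * u * δ u / g β` is
fixed by `κ`. -/
def IsStrongMonomial (κ δ : G) (β : F) (g : G) (u : F) : Prop :=
  u ≠ 0 ∧ κ • (β * (u * δ • u)) * g • β = β * (u * δ • u) * κ • g • β

/-- The map `x ↦ u * g • x` as a linear equivalence. -/
def galMonomial (k : Type*) [Field k] [Algebra k F] [SMulCommClass G k F] (g : G) {u : F}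
    (hu : u ≠ 0) : F ≃ₗ[k] F where
  toFun x := u * g • x
  invFun x := g⁻¹ • (u⁻¹ * x)
  map_add' x y := by rw [smul_add, mul_add]
  map_smul' c x := by rw [smul_comm g c x, RingHom.id_apply, mul_smul_comm]
  left_inv x := by simp [inv_mul_cancel_left₀ hu]
  right_inv x := by simp [mul_inv_cancel_left₀ hu]

theorem galMul_comm (κ δ : G) (β ω x y : F) : galMul κ δ β ω x y = galMul κ δ β ω y x := by
  unfold galMul
  rw [show β * (δ • x * y + x * δ • y) = β * (δ • y * x + y * δ • x) by ring]
  ring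

/-- In an isotopism of finite presemifields, the third component of `(M, N, L)` is automatically
a bijection. -/
theorem bijective_of_map_mul {k : Type*} [Field k] [Algebra k F] [Finite F] {mul : F → F → F}
    (hmul : IsPresemifield mul) (M N : F ≃ₗ[k] F) {L : F → F}
    (hL : ∀ x y, L (mul x y) = mul (M x) (N y)) : Function.Bijective L := by
  rw [← Finite.surjective_iff_bijective]
  intro z
  obtain ⟨w, rfl⟩ := hmul.surjective_mul_right (e := N 1) (by simp) z
  exact ⟨mul (M.symm w) 1, by rw [hL, M.apply_symm_apply]⟩

theorem exists_linearMap_midMap {k : Type*} [Field k] [Algebra k F] [SMulCommClass G k F]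
    (κ : G) (b a t : F) :
    ∃ f : F →ₗ[k] F, ∀ x, f x = midMap κ b a t x :=
  ⟨⟨⟨midMap κ b a t, fun x y => by simp only [midMap, smul_add]; ring⟩, fun c x => by
    simp only [midMap, RingHom.id_apply, smul_comm κ c x, mul_smul_comm, smul_add]⟩, fun _ => rfl⟩

namespace IsBHData

variable {κ δ : G} {β ω : F} (D : IsBHData κ δ β ω)
include D

theorem midMap_neg_midMap {b a t : F} (ha : a ∈ biFixed F κ δ) (ht : t ∈ biFixed F κ δ) (x : F) :
    midMap κ b a (-t) (midMap κ b a t x) = (a * a - t * t * (b * κ • b)) * x := by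
  rw [D.midMap_midMap ha ht, midMap]
  ring

theorem midMap_comm {b a t a' t' : F} (ha : a ∈ biFixed F κ δ) (ht : t ∈ biFixed F κ δ)
    (ha' : a' ∈ biFixed F κ δ) (ht' : t' ∈ biFixed F κ δ) (x : F) :
    midMap κ b a t (midMap κ b a' t' x) = midMap κ b a' t' (midMap κ b a t x) := by
  rw [D.midMap_midMap ha' ht', D.midMap_midMap ha ht]
  congr 1 <;> ring

/-- Every monomial satisfying the condition is the first component of a strong autotopism. -/
theorem exists_map_galMul {k : Type*} [Field k] [Algebra k F] [SMulCommClass G k F] {g : G} {u : F}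
    (hu : IsStrongMonomial κ δ β g u) : ∃ L : F →ₗ[k] F, ∀ x y,
      L (galMul κ δ β ω x y) = galMul κ δ β ω (u * g • x) (u * g • y) := by
  have hgβ : g • β ≠ 0 := (smul_ne_zero_iff_ne g).mpr D.beta_ne_zero
  have hκgβ : κ • g • β ≠ 0 := (smul_ne_zero_iff_ne κ).mpr hgβ
  have h2 := D.two_ne_zero
  have hω := D.omega_ne_zero
  have hgω : g • ω ≠ 0 := (smul_ne_zero_iff_ne g).mpr hω
  have hgκ : ∀ z : F, g • κ • z = κ • g • z := fun z => by rw [← mul_smul, mul_comm, mul_smul]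
  have hgδ : ∀ z : F, g • δ • z = δ • g • z := fun z => by rw [← mul_smul, mul_comm, mul_smul]
  set s := β * (u * δ • u) / g • β with hs
  have hsβ : β * (u * δ • u) = s * g • β := by rw [hs]; field_simp
  have hκs : κ • s = s := by
    rw [hs, smul_div₀', div_eq_div_iff hκgβ hgβ, hu.2]
  -- on `P + ω R`, with `P` and `R` fixed by `κ`, the map is `u * κ u * g P + ω * s * g R`
  let f : F → F := fun z => u * κ • u * g • ((z + κ • z) / 2) + s * ω * g • ((z - κ • z) / (2 * ω))
  refine ⟨⟨⟨f, fun x y => ?_⟩, fun c x => ?_⟩, fun x y => ?_⟩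
  · simp only [f]
    rw [smul_add κ x y, show (x + y + (κ • x + κ • y)) / 2 = (x + κ • x) / 2 + (y + κ • y) / 2 by
      ring, show (x + y - (κ • x + κ • y)) / (2 * ω) = (x - κ • x) / (2 * ω) +
      (y - κ • y) / (2 * ω) by ring, smul_add, smul_add]
    ring
  · simp only [f, RingHom.id_apply]
    have hd : ∀ z w : F, c • z / w = c • (z / w) := fun z w => smul_div_assoc c z w
    rw [smul_comm κ c x, ← smul_add, ← smul_sub, hd, hd, smul_comm g c, smul_comm g c,
      mul_smul_comm c, mul_smul_comm c, ← smul_add]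
  · change f _ = _
    set P := κ • x * y + x * κ • y with hP
    set Z := β * (δ • x * y + x * δ • y) with hZ
    have hκP : κ • P = P := by
      rw [hP, smul_add, smul_mul', smul_mul', D.smul_smul_self, D.smul_smul_self, add_comm]
    have hz : galMul κ δ β ω x y = P + (Z + κ • Z) * ω := rfl
    have hκz : κ • galMul κ δ β ω x y = P - (Z + κ • Z) * ω := by
      rw [hz, smul_add κ P, hκP, smul_mul' κ (Z + κ • Z), smul_add κ Z, D.smul_smul_self Z,
        D.smul_omega]
      ring
    have e1 : (galMul κ δ β ω x y + κ • galMul κ δ β ω x y) / 2 = P := by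
      rw [hκz, hz]; field_simp; ring
    have e2 : (galMul κ δ β ω x y - κ • galMul κ δ β ω x y) / (2 * ω) = Z + κ • Z := by
      rw [hκz, hz]; field_simp; ring
    simp only [f]
    rw [e1, e2, galMul]
    have e3 : β * (δ • (u * g • x) * (u * g • y) + u * g • x * δ • (u * g • y)) = s * g • Z := by
      rw [hZ, smul_mul', smul_mul', smul_mul', smul_add, smul_mul', smul_mul', hgδ, hgδ]
      linear_combination (δ • g • x * g • y + g • x * δ • g • y) * hsβ
    rw [e3, smul_mul' κ s, hκs, smul_add g Z, hgκ Z]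
    simp only [hP, smul_add, smul_mul', hgκ]
    ring

variable [Fintype G] [FaithfulSMul G F]

/-- Conversely a monomial strong autotopism satisfies the condition, by comparing the coefficients
of `(g * δ) • x * g • y` in the second component. -/
theorem isStrongMonomial_of_map {ℓ : G → F} {g : G} {u : F} (hu : u ≠ 0)
    (hL : ∀ x y, galLin ℓ (galMul κ δ β ω x y) =
      galMul κ δ β ω (u * g • x) (u * g • y)) : IsStrongMonomial κ δ β g u := by
  classical
  refine ⟨hu, ?_⟩
  set c : G → F := fun i => if i = g then u else 0 with hc
  have hcg : ∀ x, galLin c x = u * g • x := fun x => by simp [galLin, hc]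
  have hgκ : ∀ z : F, κ • g • z = g • κ • z := fun z => by rw [← mul_smul, mul_comm, mul_smul]
  obtain ⟨e1, e2⟩ := coeff_eq D.mul_self D.smul_omega (ℓ := ℓ) (m := c) (c := c)
    (fun x y => by rw [hL, hcg, hcg]) (δ * g) g
  have hδκ := D.delta_ne_kappa
  have hδ1 := D.delta_ne_one
  have hδδ : g ≠ δ * (δ * g) := by
    rw [← mul_assoc]
    exact fun h => D.delta_sq_ne_one (mul_eq_right.mp h.symm)
  have hδδ' : κ * g ≠ δ * (κ * (δ * g)) := by
    intro h
    rw [mul_left_comm] at h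
    exact hδδ (mul_left_cancel h)
  have z1 : coeffOne κ c c (δ * g) g = 0 := by
    have : κ * (δ * g) ≠ g := by
      rw [← mul_assoc]
      exact fun h => D.kappa_delta_ne_one (mul_eq_right.mp h)
    simp [coeffOne, galTwist_of_invol D.mul_self, hc, this, hδ1]
  have z2 : coeffTwo κ δ β c c (δ * g) g = β * (u * δ • u) := by
    have h3 : κ * (δ * g) ≠ g := by
      rw [← mul_assoc]
      exact fun h => D.kappa_delta_ne_one (mul_eq_right.mp h)
    have h4 : κ * g ≠ g := fun h => D.kappa_ne_one (mul_eq_right.mp h)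
    rw [coeffTwo, galTwist_comm, galTwist_smul, galTwist_smul, galTwist_of_invol D.mul_self c g,
      galTwist_of_invol D.mul_self c (δ * g)]
    simp only [hc, h3, h4, hδ1, mul_eq_right, if_true, if_false, smul_zero, mul_zero, zero_mul,
      add_zero, mul_comm u]
  have z3 : coeffMul κ δ β ω ℓ (δ * g) g = g • (β * ω) * (ℓ g - ℓ (κ * g)) := by
    simp [coeffMul, hδκ, hδδ]
  have hcancel : κ * (κ * g) = g := by rw [← mul_assoc, D.mul_self, one_mul]
  have z4 : coeffMul κ δ β ω ℓ (κ * (δ * g)) (κ * g) =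
      (κ * g) • (β * ω) * (ℓ (κ * g) - ℓ g) := by
    have h5 : κ * (δ * g) ≠ g := by
      rw [← mul_assoc]
      exact fun h => D.kappa_delta_ne_one (mul_eq_right.mp h)
    have h6 : κ * (δ * g) = δ * (κ * g) := mul_left_comm _ _ _
    rw [coeffMul, if_pos h6, if_neg hδδ', hcancel, if_neg h5]
    ring
  rw [z3, z1, z2] at e1
  rw [z4, z1, z2, zero_sub, smul_neg, smul_mul' κ ω, D.smul_omega, mul_smul κ, smul_mul' g,
    smul_mul' κ, hgκ ω, D.smul_omega, smul_neg] at e2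
  rw [smul_mul' g] at e1
  apply mul_left_cancel₀ D.omega_ne_zero
  linear_combination κ • g • β * e1 - g • β * e2

section Linear

variable {k : Type*} [Field k] [Algebra k F]

/-- The linear maps `Γ` with `Γ x * y = x * Γ y`. -/
theorem exists_eq_midMap_of_comm (hrep : ∀ f : F →ₗ[k] F, ∃ c : G → F, ∀ x, f x = galLin c x)
    {b : F} (hb0 : b ≠ 0) (hb : β * δ • b = κ • (β * b)) (f : F →ₗ[k] F)
    (hf : ∀ x y, galMul κ δ β ω (f x) y = galMul κ δ β ω x (f y)) :
    ∃ a ∈ biFixed F κ δ, ∃ t ∈ biFixed F κ δ, ∀ x, f x = midMap κ b a t x := by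
  obtain ⟨γ, hγ⟩ := hrep f
  simp only [hγ] at hf ⊢
  obtain ⟨a, ha, b', hb', h⟩ := D.exists_of_galMul_comm hf
  obtain ⟨t, ht, rfl⟩ := D.exists_eq_mul_of_generator hb0 hb hb'
  exact ⟨a, ha, t, ht, h⟩

variable [SMulCommClass G k F]

/-- Conjugation by the second component of an autotopism preserves the middle nucleus. -/
theorem exists_midMap_conj (hrep : ∀ f : F →ₗ[k] F, ∃ c : G → F, ∀ x, f x = galLin c x)
    {b a₀ t₀ : F} (hb0 : b ≠ 0) (hb : β * δ • b = κ • (β * b)) (ha₀ : a₀ ∈ biFixed F κ δ)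
    (ht₀ : t₀ ∈ biFixed F κ δ) (N L : F ≃ₗ[k] F)
    (hL : ∀ x y, L (galMul κ δ β ω x y) = galMul κ δ β ω (midMap κ b a₀ t₀ (N x)) (N y))
    {a t : F} (ha : a ∈ biFixed F κ δ) (ht : t ∈ biFixed F κ δ) :
    ∃ a' ∈ biFixed F κ δ, ∃ t' ∈ biFixed F κ δ, ∀ x,
      midMap κ b a t (N x) = N (midMap κ b a' t' x) := by
  obtain ⟨f, hf⟩ := exists_linearMap_midMap (k := k) κ b a t
  obtain ⟨a', ha', t', ht', h⟩ := D.exists_eq_midMap_of_comm hrep hb0 hb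
    (N.symm.toLinearMap ∘ₗ f ∘ₗ N.toLinearMap) (by
      intro x y
      apply L.injective
      simp only [LinearMap.comp_apply, LinearEquiv.coe_coe, hL, LinearEquiv.apply_symm_apply, hf]
      rw [D.midMap_comm ha₀ ht₀ ha ht, D.midMap_galMul hb ha ht])
  refine ⟨a', ha', t', ht', fun x => ?_⟩
  rw [← h, ← hf]
  simp

end Linear

end IsBHData
end Classification

/-! ### Factorization of autotopisms -/

section Factorization

variable {F G : Type*} [Field F] [CommGroup G] [MulSemiringAction G F] [Fintype G]

theorem galLin_mul_smul (c : G → F) (u : F) (g₀ : G) (x : F) :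
    galLin c (u * g₀ • x) = galLin (fun g => c (g * g₀⁻¹) * (g * g₀⁻¹) • u) x := by
  unfold galLin
  refine Fintype.sum_equiv (Equiv.mulRight g₀) _ _ fun g => ?_
  simp only [Equiv.coe_mulRight, mul_inv_cancel_right, smul_mul', mul_smul]
  ring

namespace IsBHData

variable {κ δ : G} {β ω : F} (D : IsBHData κ δ β ω)
include D

/-- Every autotopism `(M, N, L)` satisfies `M = Ω ∘ S` and `S = Ω ∘ N` with `Ω` in the middle
nucleus and `S` a monomial strong autotopism. -/
theorem exists_factorization [FaithfulSMul G F] [Finite F] {k : Type*} [Field k] [Algebra k F]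
    [SMulCommClass G k F] (hps : IsPresemifield (galMul κ δ β ω))
    (hrep : ∀ f : F →ₗ[k] F, ∃ c : G → F, ∀ x, f x = galLin c x)
    (hmono : ∀ g, ∃ u, IsStrongMonomial κ δ β g u)
    {b : F} (hb0 : b ≠ 0) (hb : β * δ • b = κ • (β * b))
    (hsq : ∀ a ∈ biFixed F κ δ, a ≠ 0 → ∃ s ∈ biFixed F κ δ, a = s * s ∨ a = s * s * (b * κ • b))
    (M N L : F ≃ₗ[k] F)
    (hL : ∀ x y, L (galMul κ δ β ω x y) = galMul κ δ β ω (M x) (N y)) :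
    ∃ a ∈ biFixed F κ δ, ∃ t ∈ biFixed F κ δ, (a ≠ 0 ∨ t ≠ 0) ∧
      ∃ g u, IsStrongMonomial κ δ β g u ∧
        ∀ x, M x = midMap κ b a t (u * g • x) ∧ u * g • x = midMap κ b a t (N x) := by
  classical
  -- commutativity of `*` shows that `M ∘ N⁻¹` lies in the middle nucleus
  obtain ⟨a₀, ha₀, t₀, ht₀, hM'⟩ := D.exists_eq_midMap_of_comm hrep hb0 hb
    (M.toLinearMap ∘ₗ N.symm.toLinearMap) (by
      intro x y
      obtain ⟨x, rfl⟩ := N.surjective x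
      obtain ⟨y, rfl⟩ := N.surjective y
      simp only [LinearMap.comp_apply, LinearEquiv.coe_coe, LinearEquiv.symm_apply_apply]
      rw [← hL, galMul_comm, hL, galMul_comm])
  have hM : ∀ x, M x = midMap κ b a₀ t₀ (N x) := fun x => by
    rw [← hM' (N x)]
    simp
  have hat₀ : a₀ ≠ 0 ∨ t₀ ≠ 0 := by
    by_contra! h
    have := hM 1
    rw [h.1, h.2, midMap, zero_mul, zero_mul, zero_mul, add_zero] at this
    exact one_ne_zero ((map_eq_zero_iff M M.injective).mp this)
  -- after composition with a monomial strong autotopism, `N` has a nonzero linear term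
  obtain ⟨c, hc⟩ := hrep N.toLinearMap
  obtain ⟨g₀, hg₀⟩ : ∃ g₀, c g₀ ≠ 0 := by
    by_contra! h
    have := hc 1
    simp [galLin, h] at this
  obtain ⟨u₀, hu₀⟩ := hmono g₀
  obtain ⟨L₀, hL₀⟩ := D.exists_map_galMul (k := k) hu₀
  set T := galMonomial k g₀ hu₀.1 with hT
  have hTx : ∀ x, T x = u₀ * g₀ • x := fun x => rfl
  have hL₀b : Function.Bijective L₀ := bijective_of_map_mul hps T T hL₀
  set L₁ : F ≃ₗ[k] F := (LinearEquiv.ofBijective L₀ hL₀b).symm.trans L with hL₁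
  set N₁ : F ≃ₗ[k] F := T.symm.trans N with hN₁
  have hNT : ∀ x, N₁ (T x) = N x := fun x => by simp [hN₁]
  have hL₁mul : ∀ x y, L₁ (galMul κ δ β ω x y) =
      galMul κ δ β ω (midMap κ b a₀ t₀ (N₁ x)) (N₁ y) := by
    intro x y
    obtain ⟨x, rfl⟩ := T.surjective x
    obtain ⟨y, rfl⟩ := T.surjective y
    have : (LinearEquiv.ofBijective L₀ hL₀b).symm (galMul κ δ β ω (T x) (T y)) =
        galMul κ δ β ω x y := by
      rw [LinearEquiv.symm_apply_eq]
      exact (hL₀ x y).symm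
    rw [hL₁, LinearEquiv.trans_apply, this, hL, hNT, hNT, hM]
  obtain ⟨c₁, hc₁⟩ := hrep N₁.toLinearMap
  obtain ⟨ℓ, hℓ⟩ := hrep L₁.toLinearMap
  simp only [LinearEquiv.coe_coe] at hc hc₁ hℓ
  have hc₁1 : c₁ 1 ≠ 0 := by
    intro h
    apply hg₀
    have := galLin_injective (fun x => ((hc x).symm.trans (hNT x).symm).trans
      ((hc₁ _).trans (galLin_mul_smul c₁ u₀ g₀ x))) g₀
    rw [this, mul_inv_cancel, h, zero_mul]
  obtain ⟨t₁, ht₁, hN₁mid⟩ := D.exists_eq_midMap hb0 hb ha₀ ht₀ hat₀ (ℓ := ℓ) hc₁1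
    (by rw [show galLin c₁ = N₁ from funext fun x => (hc₁ x).symm]; exact N₁.injective)
    (fun x y => by rw [← hℓ, ← hc₁, ← hc₁, hL₁mul])
    (fun a ha t ht => by
      simpa only [← hc₁] using D.exists_midMap_conj hrep hb0 hb ha₀ ht₀ N₁ L₁ hL₁mul ha ht)
  simp only [← hc₁] at hN₁mid
  generalize c₁ 1 = v at hN₁mid hc₁1
  -- the middle nucleus element relating the monomials is a scalar
  have h1E := one_mem (biFixed F κ δ)
  have heE := D.norm_mem hb
  obtain ⟨a₂, ha₂, t₂, ht₂, h₂⟩ : ∃ a₂ ∈ biFixed F κ δ, ∃ t₂ ∈ biFixed F κ δ, ∀ z,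
      midMap κ b 1 t₁ (midMap κ b a₀ t₀ (midMap κ b 1 t₁ z)) = midMap κ b a₂ t₂ z := by
    have ha' : a₀ * 1 + t₀ * t₁ * (b * κ • b) ∈ biFixed F κ δ :=
      add_mem (mul_mem ha₀ h1E) (mul_mem (mul_mem ht₀ ht₁) heE)
    have ht' : a₀ * t₁ + t₀ * 1 ∈ biFixed F κ δ :=
      add_mem (mul_mem ha₀ ht₁) (mul_mem ht₀ h1E)
    refine ⟨_, ?_, _, ?_, fun z => by
      rw [D.midMap_midMap h1E ht₁, D.midMap_midMap ha' ht']⟩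
    · exact add_mem (mul_mem h1E ha') (mul_mem (mul_mem ht₁ ht') heE)
    · exact add_mem (mul_mem h1E ht') (mul_mem ht₁ ha')
  have hL₂ : ∀ x y, L₁ (galMul κ δ β ω x y) =
      galMul κ δ β ω (midMap κ b a₂ t₂ (v * x)) (v * y) := by
    intro x y
    rw [hL₁mul, hN₁mid, hN₁mid, ← D.midMap_galMul hb h1E ht₁, h₂]
  have ht₂0 : t₂ = 0 := by
    set w : G → F := fun g => if g = 1 then v else 0 with hw
    have hwx : ∀ x, galLin w x = v * x := fun x => by simp [galLin, hw]
    have h3 := (coeff_eq_zero D.mul_self D.smul_omega D.omega_ne_zero D.two_ne_zero (ℓ := ℓ)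
      (m := fun g => a₂ * w g + t₂ * b * galTwist κ w g) (c := w)
      (fun x y => by rw [← hℓ, hL₂, ← midMap_galLin, hwx, hwx])
      (D.offLines_self 1).1 (D.offLines_self 1).2.1 (D.offLines_self 1).2.2).1
    have h4 := D.coeffOne_mid (b := b) ha₂ ht₂ (one_mul 1) w 1 1
    rw [h3, galTwist_of_invol D.mul_self] at h4
    simp only [hw, mul_one, D.kappa_ne_one, if_true, if_false, smul_zero, mul_zero, zero_mul,
      add_zero] at h4
    have he0 : b * κ • b ≠ 0 := mul_ne_zero hb0 ((smul_ne_zero_iff_ne κ).mpr hb0)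
    simpa [hc₁1, he0, hb0] using h4.symm
  subst ht₂0
  have ha₂0 : a₂ ≠ 0 := by
    rintro rfl
    have h3 := hL₂ 1 1
    have h4 : galMul κ δ β ω 0 (v * 1) = 0 := by simp [galMul]
    rw [midMap, zero_mul, zero_mul, zero_mul, add_zero, h4] at h3
    have h5 := (map_eq_zero_iff L₁ L₁.injective).mp h3
    rcases hps.eq_zero_or_eq_zero _ _ h5 with h | h <;> exact one_ne_zero h
  -- a square root of this scalar in the middle nucleus, which is again monomial
  obtain ⟨p, hp, w, hw, hpw, hpw2⟩ : ∃ p ∈ biFixed F κ δ, ∃ w ∈ biFixed F κ δ,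
      (p = 0 ∧ w ≠ 0 ∨ w = 0 ∧ p ≠ 0) ∧ p * p + w * w * (b * κ • b) = a₂ := by
    obtain ⟨s, hs, h | h⟩ := hsq a₂ ha₂ ha₂0
    · refine ⟨s, hs, 0, zero_mem _, Or.inr ⟨rfl, ?_⟩, by rw [h]; ring⟩
      rintro rfl
      exact ha₂0 (by rw [h, mul_zero])
    · refine ⟨0, zero_mem _, s, hs, Or.inl ⟨rfl, ?_⟩, by rw [h]; ring⟩
      rintro rfl
      exact ha₂0 (by rw [h, mul_zero, zero_mul])
  have hpw0 : p * w = 0 := by rcases hpw with h | h <;> simp [h.1]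
  set n := 1 * 1 - t₁ * t₁ * (b * κ • b) with hn
  have hn0 : n ≠ 0 := D.sq_sub_ne_zero hb0 hb h1E ht₁ (Or.inl one_ne_zero)
  have hnE : n ∈ biFixed F κ δ := sub_mem (mul_mem h1E h1E) (mul_mem (mul_mem ht₁ ht₁) heE)
  have hi₁ : 1 / n ∈ biFixed F κ δ := div_mem h1E hnE
  have hi₂ : -t₁ / n ∈ biFixed F κ δ := div_mem (neg_mem ht₁) hnE
  set a := p * (1 / n) + w * (-t₁ / n) * (b * κ • b) with ha
  set t := p * (-t₁ / n) + w * (1 / n) with ht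
  have haE : a ∈ biFixed F κ δ := add_mem (mul_mem hp hi₁) (mul_mem (mul_mem hw hi₂) heE)
  have htE : t ∈ biFixed F κ δ := add_mem (mul_mem hp hi₂) (mul_mem hw hi₁)
  have hinv : ∀ z, midMap κ b (1 / n) (-t₁ / n) (midMap κ b 1 t₁ z) = z := by
    intro z
    rw [D.midMap_midMap h1E ht₁, midMap]
    have e1 : 1 / n * 1 + -t₁ / n * t₁ * (b * κ • b) = 1 := by
      field_simp
      rw [hn]
      ring
    have e2 : 1 / n * t₁ + -t₁ / n * 1 = 0 := by ring
    rw [e1, e2]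
    ring
  have hΩ : ∀ z, midMap κ b a t (midMap κ b 1 t₁ z) = midMap κ b p w z := by
    intro z
    rw [ha, ht, ← D.midMap_midMap hi₁ hi₂, hinv]
  have hS : ∀ x, midMap κ b a t (N x) = midMap κ b p w (v * T x) := by
    intro x
    rw [← hNT, hN₁mid, hΩ]
  have hMS : ∀ x, M x = midMap κ b a t (midMap κ b a t (N x)) := by
    intro x
    have hinj : Function.Injective (midMap κ b 1 t₁) := Function.LeftInverse.injective hinv
    apply hinj
    rw [hM, hS, D.midMap_comm h1E ht₁ haE htE, ← hNT, hN₁mid, h₂,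
      hΩ, D.midMap_midMap hp hw, hpw2]
    simp only [midMap, mul_comm w p, hpw0]
    ring
  have hat : a ≠ 0 ∨ t ≠ 0 := by
    by_contra! h
    have := hMS 1
    rw [h.1, h.2, midMap, zero_mul, zero_mul, zero_mul, add_zero] at this
    exact one_ne_zero ((map_eq_zero_iff M M.injective).mp this)
  obtain ⟨g, u, hu0, hgu⟩ : ∃ g : G, ∃ u : F, u ≠ 0 ∧
      ∀ x, u * g • x = midMap κ b a t (N x) := by
    rcases hpw with ⟨rfl, hw0⟩ | ⟨rfl, hp0⟩
    · refine ⟨κ * g₀, w * b * κ • (v * u₀), mul_ne_zero (mul_ne_zero hw0 hb0)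
        ((smul_ne_zero_iff_ne κ).mpr (mul_ne_zero hc₁1 hu₀.1)), fun x => ?_⟩
      rw [hS, midMap, hTx, mul_smul, ← mul_assoc v, smul_mul' κ (v * u₀)]
      ring
    · refine ⟨g₀, p * v * u₀, mul_ne_zero (mul_ne_zero hp0 hc₁1) hu₀.1, fun x => ?_⟩
      rw [hS, midMap, hTx]
      ring
  obtain ⟨ℓ', hℓ'⟩ := hrep L.toLinearMap
  refine ⟨a, haE, t, htE, hat, g, u, D.isStrongMonomial_of_map (ℓ := ℓ') hu0 fun x y => ?_,
    fun x => ⟨by rw [hgu, hMS], hgu x⟩⟩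
  rw [← hℓ', LinearEquiv.coe_coe, hL, hMS, D.midMap_galMul hb haE htE, hgu, hgu]

end IsBHData
end Factorization

/-! ### Strong autotopisms up to the middle nucleus, and the count -/

section Counting

theorem card_eq_two_mul_of_card_fiber {X Y : Type*} [Finite X] [Finite Y] (f : X → Y)
    (hf : ∀ y, Nat.card {x // f x = y} = 2) : Nat.card X = 2 * Nat.card Y := by
  have := Fintype.ofFinite Y
  rw [Nat.card_congr (Equiv.sigmaFiberEquiv f).symm, Nat.card_sigma]
  simp [hf, mul_comm]

variable {F G : Type*} [Field F] [CommGroup G] [MulSemiringAction G F]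

namespace IsBHData

variable {κ δ : G} {β ω : F} (D : IsBHData κ δ β ω)
include D

theorem midMap_injective {b a t : F} (hb0 : b ≠ 0) (hb : β * δ • b = κ • (β * b))
    (ha : a ∈ biFixed F κ δ) (ht : t ∈ biFixed F κ δ) (hat : a ≠ 0 ∨ t ≠ 0) :
    Function.Injective (midMap κ b a t) := by
  intro x y hxy
  have h := congrArg (midMap κ b a (-t)) hxy
  rw [D.midMap_neg_midMap ha ht, D.midMap_neg_midMap ha ht] at h
  exact mul_left_cancel₀ (D.sq_sub_ne_zero hb0 hb ha ht hat) h

/-- The elements of the middle nucleus of the associated semifield are the `Ω 1 * 1`, and their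
left multiplications are the maps `Ω`, transported by `x ↦ x * 1`. -/
theorem isotopeMul_midMap [Finite F] (hps : IsPresemifield (galMul κ δ β ω)) {b a t : F}
    (hb : β * δ • b = κ • (β * b)) (ha : a ∈ biFixed F κ δ) (ht : t ∈ biFixed F κ δ) :
    galMul κ δ β ω (midMap κ b a t 1) 1 ∈ middleNucleus (isotopeMul (galMul κ δ β ω) 1) ∧
      ∀ x, isotopeMul (galMul κ δ β ω) 1 (galMul κ δ β ω (midMap κ b a t 1) 1)
        (galMul κ δ β ω x 1) = galMul κ δ β ω (midMap κ b a t x) 1 := by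
  have happly : ∀ x y, isotopeMul (galMul κ δ β ω) 1 (galMul κ δ β ω x 1) (galMul κ δ β ω y 1) =
      galMul κ δ β ω x y := by
    intro x y
    rw [galMul_comm κ δ β ω y 1, isotopeMul_apply hps one_ne_zero]
  have hmid := D.midMap_galMul hb ha ht
  have hleft : ∀ x, isotopeMul (galMul κ δ β ω) 1 (galMul κ δ β ω (midMap κ b a t 1) 1)
        (galMul κ δ β ω x 1) = galMul κ δ β ω (midMap κ b a t x) 1 := by
    intro x
    rw [happly, hmid, galMul_comm]
  refine ⟨fun X Y => ?_, hleft⟩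
  obtain ⟨x, rfl⟩ := hps.surjective_mul_right one_ne_zero X
  obtain ⟨y, rfl⟩ := hps.surjective_mul_right one_ne_zero Y
  simp only [hleft]
  rw [happly, ← hmid, happly, happly, hmid]

/-- Every autotopism is strong up to the middle nucleus. -/
theorem exists_strong_up_to_middleNucleus [Fintype G] [FaithfulSMul G F] [Finite F]
    {k : Type*} [Field k] [Algebra k F]
    [SMulCommClass G k F] (hps : IsPresemifield (galMul κ δ β ω))
    (hrep : ∀ f : F →ₗ[k] F, ∃ c : G → F, ∀ x, f x = galLin c x)
    (hmono : ∀ g, ∃ u, IsStrongMonomial κ δ β g u)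
    {b : F} (hb0 : b ≠ 0) (hb : β * δ • b = κ • (β * b))
    (hsq : ∀ a ∈ biFixed F κ δ, a ≠ 0 → ∃ s ∈ biFixed F κ δ, a = s * s ∨ a = s * s * (b * κ • b))
    (M N L : F ≃ₗ[k] F)
    (hL : ∀ x y, L (galMul κ δ β ω x y) = galMul κ δ β ω (M x) (N y)) :
    ∃ γ ∈ middleNucleus (isotopeMul (galMul κ δ β ω) 1), γ ≠ 0 ∧
      ∃ N₀ : F ≃ₗ[k] F, (∀ x y, L (galMul κ δ β ω x y) = galMul κ δ β ω (N₀ x) (N₀ y)) ∧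
        ∀ x, galMul κ δ β ω (M x) 1 =
            isotopeMul (galMul κ δ β ω) 1 γ (galMul κ δ β ω (N₀ x) 1) ∧
          galMul κ δ β ω (N₀ x) 1 =
            isotopeMul (galMul κ δ β ω) 1 γ (galMul κ δ β ω (N x) 1) := by
  obtain ⟨a, ha, t, ht, hat, g, u, hgu, h⟩ := D.exists_factorization hps hrep hmono hb0 hb hsq
    M N L hL
  obtain ⟨h1, h2⟩ := D.isotopeMul_midMap hps hb ha ht
  have hinj := D.midMap_injective hb0 hb ha ht hat
  refine ⟨_, h1, fun h0 => ?_, galMonomial k g hgu.1, fun x y => ?_, fun x => ⟨?_, ?_⟩⟩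
  · rcases hps.eq_zero_or_eq_zero _ _ h0 with h0 | h0
    · have h3 : midMap κ b a t 0 = 0 := by simp [midMap]
      exact one_ne_zero (hinj (h0.trans h3.symm))
    · exact one_ne_zero h0
  · change _ = galMul κ δ β ω (u * g • x) (u * g • y)
    rw [hL, (h x).1, (h y).2, D.midMap_galMul hb ha ht]
  · rw [h2, (h x).1]
    rfl
  · rw [h2, ← (h x).2]
    rfl

/-- The pairs `(Ω, S)` of a nonzero element of the middle nucleus and a strong autotopism
cover the autotopisms twice, since `(Ω S, Ω⁻¹ S)` determines `(Ω, S)` up to sign. -/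
theorem two_mul_card_autotopism [Fintype G] [FaithfulSMul G F] [Finite F]
    {k : Type*} [Field k] [Algebra k F]
    [SMulCommClass G k F] (hps : IsPresemifield (galMul κ δ β ω))
    (hrep : ∀ f : F →ₗ[k] F, ∃ c : G → F, ∀ x, f x = galLin c x)
    (hmono : ∀ g, ∃ u, IsStrongMonomial κ δ β g u)
    {b : F} (hb0 : b ≠ 0) (hb : β * δ • b = κ • (β * b))
    (hsq : ∀ a ∈ biFixed F κ δ, a ≠ 0 → ∃ s ∈ biFixed F κ δ, a = s * s ∨ a = s * s * (b * κ • b)) :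
    2 * Nat.card {T : (F ≃ₗ[k] F) × (F ≃ₗ[k] F) × (F ≃ₗ[k] F) //
      ∀ x y, T.2.2 (galMul κ δ β ω x y) = galMul κ δ β ω (T.1 x) (T.2.1 y)} =
    Nat.card ({z : biFixed F κ δ × biFixed F κ δ // z ≠ 0} ×
      (Σ g : G, {u : F // IsStrongMonomial κ δ β g u})) := by
  set X := {z : biFixed F κ δ × biFixed F κ δ // z ≠ 0} ×
      (Σ g : G, {u : F // IsStrongMonomial κ δ β g u}) with hX
  set Y := {T : (F ≃ₗ[k] F) × (F ≃ₗ[k] F) × (F ≃ₗ[k] F) //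
      ∀ x y, T.2.2 (galMul κ δ β ω x y) = galMul κ δ β ω (T.1 x) (T.2.1 y)} with hY
  have hne : ∀ z : biFixed F κ δ × biFixed F κ δ, z ≠ 0 → (z.1 : F) ≠ 0 ∨ (z.2 : F) ≠ 0 := by
    intro z hz
    by_contra! h
    exact hz (Prod.ext (Subtype.ext h.1) (Subtype.ext h.2))
  have hinj : ∀ z : {z : biFixed F κ δ × biFixed F κ δ // z ≠ 0},
      Function.Injective (midMap κ b (z.1.1 : F) (z.1.2 : F)) := fun z =>
    D.midMap_injective hb0 hb z.1.1.2 z.1.2.2 (hne _ z.2)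
  have hex : ∀ w : X, ∃ T : Y,
      (∀ x, T.1.1 x = midMap κ b (w.1.1.1 : F) (w.1.1.2 : F) (w.2.2.1 * w.2.1 • x)) ∧
      ∀ x, w.2.2.1 * w.2.1 • x = midMap κ b (w.1.1.1 : F) (w.1.1.2 : F) (T.1.2.1 x) := by
    rintro ⟨z, g, u, hu⟩
    obtain ⟨f, hf⟩ := exists_linearMap_midMap (k := k) κ b (z.1.1 : F) (z.1.2 : F)
    have hfi : Function.Injective f := by
      rw [show (f : F → F) = midMap κ b (z.1.1 : F) (z.1.2 : F) from funext hf]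
      exact hinj z
    set W : F ≃ₗ[k] F := LinearEquiv.ofBijective f ⟨hfi, Finite.surjective_of_injective hfi⟩
    have hW : ∀ x, W x = midMap κ b (z.1.1 : F) (z.1.2 : F) x := hf
    set S := galMonomial k g hu.1
    have hS : ∀ x, S x = u * g • x := fun _ => rfl
    obtain ⟨L, hL⟩ := D.exists_map_galMul (k := k) hu
    have hmul : ∀ x y, L (galMul κ δ β ω x y) =
        galMul κ δ β ω (S.trans W x) (S.trans W.symm y) := by
      intro x y
      rw [LinearEquiv.trans_apply, hW, D.midMap_galMul hb z.1.1.2 z.1.2.2, ← hW,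
        LinearEquiv.trans_apply, W.apply_symm_apply, hL, hS, hS]
    refine ⟨⟨(S.trans W, S.trans W.symm,
      LinearEquiv.ofBijective L (bijective_of_map_mul hps _ _ hmul)), hmul⟩, fun x => ?_,
      fun x => ?_⟩
    · change W (S x) = _
      rw [hW, hS]
    · change _ = midMap κ b _ _ (W.symm (S x))
      rw [← hW, W.apply_symm_apply, hS]
  choose f hf1 hf2 using hex
  have hfinE : Finite (F ≃ₗ[k] F) := Finite.of_injective (fun e => (e : F → F))
    DFunLike.coe_injective
  have hdet : ∀ T T' : Y, (∀ x, T.1.1 x = T'.1.1 x) → (∀ x, T.1.2.1 x = T'.1.2.1 x) →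
      T = T' := by
    rintro ⟨⟨M, N, L⟩, hT⟩ ⟨⟨M', N', L'⟩, hT'⟩ h1 h2
    obtain rfl : M = M' := LinearEquiv.ext h1
    obtain rfl : N = N' := LinearEquiv.ext h2
    have : L = L' := by
      ext z
      obtain ⟨x, rfl⟩ := hps.surjective_mul_right one_ne_zero z
      exact (hT x 1).trans (hT' x 1).symm
    subst this
    rfl
  have hneg : ∀ w : X, ∃ w' : X, (w'.1.1.1 : F) = -w.1.1.1 ∧ (w'.1.1.2 : F) = -w.1.1.2 ∧
      w'.2.1 = w.2.1 ∧ w'.2.2.1 = -w.2.2.1 := by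
    rintro ⟨z, g, u, hu⟩
    refine ⟨⟨⟨-z.1, neg_ne_zero.mpr z.2⟩, g, -u, neg_ne_zero.mpr hu.1, ?_⟩, rfl, rfl, rfl, rfl⟩
    rw [smul_neg, neg_mul_neg]
    exact hu.2
  have hXext : ∀ w w' : X, (w.1.1.1 : F) = w'.1.1.1 → (w.1.1.2 : F) = w'.1.1.2 →
      w.2.1 = w'.2.1 → w.2.2.1 = w'.2.2.1 → w = w' := by
    rintro ⟨⟨⟨a, t⟩, h⟩, g, u, hu⟩ ⟨⟨⟨a', t'⟩, h'⟩, g', u', hu'⟩ h1 h2 h3 h4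
    obtain rfl : a = a' := Subtype.ext h1
    obtain rfl : t = t' := Subtype.ext h2
    obtain rfl : g = g' := h3
    obtain rfl : u = u' := h4
    rfl
  have hsame : ∀ w w' : X, (w'.1.1.1 : F) = -w.1.1.1 → (w'.1.1.2 : F) = -w.1.1.2 →
      w'.2.1 = w.2.1 → w'.2.2.1 = -w.2.2.1 → f w' = f w := by
    intro w w' h1 h2 h3 h4
    apply hdet
    · intro x
      rw [hf1, hf1, h1, h2, h4, h3]
      simp only [midMap, neg_mul, smul_neg]
      ring
    · intro x
      apply hinj w.1
      rw [← hf2 w]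
      have := hf2 w' x
      rw [h1, h2, h4, h3] at this
      simp only [midMap] at this ⊢
      linear_combination this
  have hpm : ∀ w w' : X, f w = f w' → w = w' ∨ ((w.1.1.1 : F) = -w'.1.1.1 ∧
      (w.1.1.2 : F) = -w'.1.1.2 ∧ w.2.1 = w'.2.1 ∧ w.2.2.1 = -w'.2.2.1) := by
    intro w w' hww
    set a := (w.1.1.1 : F) with ha
    set t := (w.1.1.2 : F) with ht
    set a' := (w'.1.1.1 : F) with ha'
    set t' := (w'.1.1.2 : F) with ht'
    have haE : a ∈ biFixed F κ δ := w.1.1.1.2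
    have htE : t ∈ biFixed F κ δ := w.1.1.2.2
    have haE' : a' ∈ biFixed F κ δ := w'.1.1.1.2
    have htE' : t' ∈ biFixed F κ δ := w'.1.1.2.2
    have hsqr : ∀ y, midMap κ b a t (midMap κ b a t y) = midMap κ b a' t' (midMap κ b a' t' y) := by
      intro y
      obtain ⟨x, rfl⟩ := (f w).1.2.1.surjective y
      rw [← hf2, ← hf1, hww, ← hf2, ← hf1]
    have hprod : ∀ y, midMap κ b (a - a') (t - t') (midMap κ b (a + a') (t + t') y) = 0 := by
      intro y
      have h1 := hsqr y
      have h2 := D.midMap_comm (b := b) haE htE haE' htE' y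
      simp only [midMap, smul_add, smul_mul', haE.1, htE.1, haE'.1, htE'.1] at h1 h2 ⊢
      linear_combination h1 + h2
    by_cases h1 : a - a' ≠ 0 ∨ t - t' ≠ 0
    · by_cases h2 : a + a' ≠ 0 ∨ t + t' ≠ 0
      · exfalso
        have i1 := D.midMap_injective hb0 hb (sub_mem haE haE') (sub_mem htE htE') h1
        have i2 := D.midMap_injective hb0 hb (add_mem haE haE') (add_mem htE htE') h2
        exact one_ne_zero (i2 (i1 ((hprod 1).trans (hprod 0).symm)))
      · right
        push Not at h2
        have e1 : a = -a' := eq_neg_of_add_eq_zero_left h2.1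
        have e2 : t = -t' := eq_neg_of_add_eq_zero_left h2.2
        have hS : ∀ x, w.2.2.1 * w.2.1 • x = -(w'.2.2.1 * w'.2.1 • x) := by
          intro x
          rw [hf2, hf2, hww, ← ha, ← ht, ← ha', ← ht', e1, e2]
          simp only [midMap]
          ring
        have hu : w.2.2.1 = -w'.2.2.1 := by simpa using hS 1
        refine ⟨e1, e2, ?_, hu⟩
        apply FaithfulSMul.eq_of_smul_eq_smul (α := F)
        intro x
        apply mul_left_cancel₀ w.2.2.2.1
        rw [hS, hu]
        ring
    · left
      push Not at h1
      have e1 : a = a' := sub_eq_zero.mp h1.1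
      have e2 : t = t' := sub_eq_zero.mp h1.2
      have hS : ∀ x, w.2.2.1 * w.2.1 • x = w'.2.2.1 * w'.2.1 • x := by
        intro x
        rw [hf2, hf2, hww, ← ha, ← ht, ← ha', ← ht', e1, e2]
      have hu : w.2.2.1 = w'.2.2.1 := by simpa using hS 1
      refine hXext _ _ e1 e2 ?_ hu
      apply FaithfulSMul.eq_of_smul_eq_smul (α := F)
      intro x
      apply mul_left_cancel₀ w.2.2.2.1
      rw [hS, hu]
  symm
  apply card_eq_two_mul_of_card_fiber f
  intro T
  obtain ⟨a, ha, t, ht, hat, g, u, hgu, h⟩ := D.exists_factorization hps hrep hmono hb0 hb hsq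
    T.1.1 T.1.2.1 T.1.2.2 T.2
  have hz : ((⟨a, ha⟩, ⟨t, ht⟩) : biFixed F κ δ × biFixed F κ δ) ≠ 0 := by
    intro h0
    rcases hat with hat | hat
    · exact hat (congrArg (fun z => (z.1 : F)) h0)
    · exact hat (congrArg (fun z => (z.2 : F)) h0)
  set w : X := ⟨⟨(⟨a, ha⟩, ⟨t, ht⟩), hz⟩, g, u, hgu⟩ with hw
  have hfw : f w = T := by
    apply hdet
    · intro x
      rw [hf1, (h x).1]
    · intro x
      apply hinj w.1
      rw [← hf2 w]
      exact (h x).2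
  obtain ⟨w', h1, h2, h3, h4⟩ := hneg w
  have hfw' : f w' = T := (hsame w w' h1 h2 h3 h4).trans hfw
  rw [Nat.card_eq_two_iff]
  refine ⟨⟨w, hfw⟩, ⟨w', hfw'⟩, ?_, ?_⟩
  · intro he
    have he' : w = w' := congrArg Subtype.val he
    rw [← he'] at h4
    exact hgu.1 (D.eq_zero_of_eq_neg h4)
  · rw [Set.eq_univ_iff_forall]
    rintro ⟨v, hv⟩
    rcases hpm v w (hv.trans hfw.symm) with e | ⟨e1, e2, e3, e4⟩
    · left
      exact Subtype.ext e
    · right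
      apply Subtype.ext
      refine hXext _ _ ?_ ?_ ?_ ?_
      · rw [h1, e1]
      · rw [h2, e2]
      · rw [h3, e3]
      · rw [h4, e4]

end IsBHData
end Counting

/-! ### Cyclic groups, finite fields and powers of Frobenius -/

section CyclicGroups

theorem pow_eq_self_of_coprime {A : Type*} [Monoid A] {q : ℕ} {x : A} {m n : ℕ} (hmn : Nat.Coprime m n) (hm : x ^ q ^ m = x)
    (hn : x ^ q ^ n = x) : x ^ q = x := by
  have hit : ∀ (n : ℕ) (z : A), (fun z : A => z ^ q)^[n] z = z ^ q ^ n := by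
    intro n z
    induction n with
    | zero => simp
    | succ n ih => rw [Function.iterate_succ_apply', ih, pow_succ, pow_mul]
  have h1 : Function.IsPeriodicPt (fun z : A => z ^ q) m x := (hit m x).trans hm
  have h2 : Function.IsPeriodicPt (fun z : A => z ^ q) n x := (hit n x).trans hn
  have h3 := h1.gcd h2
  rw [hmn.gcd_eq_one] at h3
  exact h3

theorem pow_pow_eq_self {A : Type*} [Monoid A] {q : ℕ} {x : A} (hx : x ^ q = x) (n : ℕ) : x ^ q ^ n = x := by
  induction n with
  | zero => simp
  | succ n ih => rw [pow_succ, pow_mul, ih, hx]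

theorem exists_pow_eq_pow_gcd {A : Type*} [CommGroup A] [Finite A] (m : ℕ) (w : A) :
    ∃ y, y ^ m = w ^ (Nat.card A).gcd m := by
  refine ⟨w ^ (Nat.gcdB (Nat.card A) m), ?_⟩
  rw [← zpow_natCast w, Nat.gcd_eq_gcd_ab, zpow_add, zpow_mul, zpow_natCast w, pow_card_eq_one',
    one_zpow, one_mul, mul_comm (m : ℤ), zpow_mul, zpow_natCast]

theorem card_pow_eq {A : Type*} [CommGroup A] [IsCyclic A] [Finite A] {m : ℕ} {y₀ z : A}
    (h : y₀ ^ m = z) : Nat.card {y : A // y ^ m = z} = (Nat.card A).gcd m := by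
  rw [← IsCyclic.card_powMonoidHom_ker A m]
  refine Nat.card_congr ⟨fun y => ⟨y.1 / y₀, ?_⟩, fun y => ⟨y.1 * y₀, ?_⟩, fun y => ?_, fun y => ?_⟩
  · rw [MonoidHom.mem_ker, powMonoidHom_apply, div_pow, y.2, h, div_self']
  · have := y.2
    rw [MonoidHom.mem_ker, powMonoidHom_apply] at this
    rw [mul_pow, this, h, one_mul]
  · simp
  · simp

theorem gcd_pow_add_one_eq_two {q l d : ℕ} (hq : Odd q) (hld : Nat.Coprime l d)
    (hodd : Odd (l + d)) : (q ^ l + 1).gcd (q ^ d + 1) = 2 := by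
  apply Nat.dvd_antisymm
  · set g := (q ^ l + 1).gcd (q ^ d + 1) with hg
    have h1 : ((q : ZMod g)) ^ l = -1 := by
      have : ((q ^ l + 1 : ℕ) : ZMod g) = 0 :=
        (ZMod.natCast_eq_zero_iff _ _).mpr (Nat.gcd_dvd_left _ _)
      push_cast at this
      exact eq_neg_of_add_eq_zero_left this
    have h2 : ((q : ZMod g)) ^ d = -1 := by
      have : ((q ^ d + 1 : ℕ) : ZMod g) = 0 :=
        (ZMod.natCast_eq_zero_iff _ _).mpr (Nat.gcd_dvd_right _ _)
      push_cast at this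
      exact eq_neg_of_add_eq_zero_left this
    have h3 : orderOf (q : ZMod g) ∣ l * 2 :=
      orderOf_dvd_of_pow_eq_one (by rw [pow_mul, h1, neg_one_sq])
    have h4 : orderOf (q : ZMod g) ∣ d * 2 :=
      orderOf_dvd_of_pow_eq_one (by rw [pow_mul, h2, neg_one_sq])
    have h5 : (q : ZMod g) ^ 2 = 1 := by
      rw [← orderOf_dvd_iff_pow_eq_one]
      have := Nat.dvd_gcd h3 h4
      rwa [Nat.gcd_mul_right, hld.gcd_eq_one, one_mul] at this
    have h6 : ∀ n, Even n → (q : ZMod g) ^ n = -1 → g ∣ 2 := by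
      rintro n ⟨m, rfl⟩ hn
      rw [← two_mul, pow_mul, h5, one_pow] at hn
      have : ((2 : ℕ) : ZMod g) = 0 := by
        push_cast
        linear_combination hn
      exact (ZMod.natCast_eq_zero_iff _ _).mp this
    rcases Nat.even_or_odd l with h | h
    · exact h6 l h h1
    · refine h6 d ?_ h2
      rcases Nat.even_or_odd d with h7 | h7
      · exact h7
      · exact absurd (h.add_odd h7) (Nat.not_even_iff_odd.mpr hodd)
  · exact Nat.dvd_gcd (hq.pow.add_one).two_dvd (hq.pow.add_one).two_dvd

end CyclicGroups

section FiniteField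

/-- The squares have index two in the unit group of a finite field. -/
theorem exists_sq_or_sq_mul {K : Type*} [Field K] [Finite K] {e : K} (he : ¬ IsSquare e) (a : K) :
    ∃ s, a = s * s ∨ a = s * s * e := by
  classical
  have := Fintype.ofFinite K
  by_cases ha : IsSquare a
  · obtain ⟨s, hs⟩ := ha
    exact ⟨s, Or.inl hs⟩
  · have he0 : e ≠ 0 := fun h => he (h ▸ IsSquare.zero)
    have ha0 : a ≠ 0 := fun h => ha (h ▸ IsSquare.zero)
    have h1 : quadraticChar K (a * e) = 1 := by
      rw [map_mul, quadraticChar_neg_one_iff_not_isSquare.mpr ha,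
        quadraticChar_neg_one_iff_not_isSquare.mpr he]
      rfl
    obtain ⟨s, hs⟩ := (quadraticChar_one_iff_isSquare (mul_ne_zero ha0 he0)).mp h1
    refine ⟨s / e, Or.inr ?_⟩
    field_simp
    linear_combination hs

open scoped IsMulCommutative

variable {p : ℕ} [Fact p.Prime] {F : Type*} [Field F] [Finite F] [Algebra (ZMod p) F]

/-- The automorphism `x ↦ x ^ p ^ n`. -/
noncomputable def frobPow (p : ℕ) [Fact p.Prime] (F : Type*) [Field F] [Finite F]
    [Algebra (ZMod p) F] (n : ℕ) : F ≃ₐ[ZMod p] F :=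
  FiniteField.frobeniusAlgEquivOfAlgebraic (ZMod p) F ^ n

theorem frobPow_smul (n : ℕ) (x : F) : frobPow p F n • x = x ^ p ^ n := by
  rw [frobPow, AlgEquiv.smul_def, AlgEquiv.coe_pow,
    FiniteField.coe_frobeniusAlgEquivOfAlgebraic_iterate, ZMod.card]

theorem frobPow_mul (m n : ℕ) : frobPow p F m * frobPow p F n = frobPow p F (m + n) :=
  (pow_add _ _ _).symm

theorem frobPow_eq_one_iff (n : ℕ) :
    frobPow p F n = 1 ↔ Module.finrank (ZMod p) F ∣ n := by
  rw [frobPow, ← orderOf_dvd_iff_pow_eq_one, FiniteField.orderOf_frobeniusAlgEquivOfAlgebraic]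

theorem exists_eq_frobPow (g : F ≃ₐ[ZMod p] F) : ∃ n, g = frobPow p F n := by
  obtain ⟨n, hn⟩ := (FiniteField.bijective_frobeniusAlgEquivOfAlgebraic_pow (ZMod p) F).2 g
  exact ⟨n, hn.symm⟩

theorem finrank_eq_of_card {n : ℕ} (hF : Nat.card F = p ^ n) : Module.finrank (ZMod p) F = n := by
  have := Module.natCard_eq_pow_finrank (K := ZMod p) (V := F)
  rw [hF, Nat.card_zmod] at this
  exact (Nat.pow_right_injective (Fact.out : p.Prime).two_le this).symm

/-- Every `𝔽_p`-linear endomorphism of a finite field is a linearized polynomial: the Galois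
automorphisms are independent, and there are enough of them. -/
theorem exists_eq_galLin (f : F →ₗ[ZMod p] F) :
    ∃ c : (F ≃ₐ[ZMod p] F) → F, ∀ x, f x = galLin c x := by
  have hmap : ∀ c : (F ≃ₐ[ZMod p] F) → F, ∃ f : F →ₗ[ZMod p] F, ∀ x, f x = galLin c x := by
    intro c
    refine ⟨⟨⟨galLin c, fun x y => ?_⟩, fun a x => ?_⟩, fun _ => rfl⟩
    · simp only [galLin, smul_add, mul_add, Finset.sum_add_distrib]
    · simp only [galLin, RingHom.id_apply, Finset.smul_sum, AlgEquiv.smul_def, map_smul,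
        mul_smul_comm]
  choose Φ hΦ using hmap
  have hinj : Function.Injective Φ := by
    intro c c' h
    funext g
    exact galLin_injective (fun x => by rw [← hΦ, ← hΦ, h]) g
  have hfin : Finite (F →ₗ[ZMod p] F) := Finite.of_injective (fun e => (e : F → F))
    DFunLike.coe_injective
  have hcard : Nat.card (F →ₗ[ZMod p] F) ≤ Nat.card ((F ≃ₐ[ZMod p] F) → F) := by
    rw [Nat.card_fun, Module.natCard_eq_pow_finrank (K := ZMod p) (V := F →ₗ[ZMod p] F),
      Module.finrank_linearMap, Module.natCard_eq_pow_finrank (K := ZMod p) (V := F),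
      IsGalois.card_aut_eq_finrank, pow_mul]
  obtain ⟨c, hc⟩ := (hinj.bijective_of_nat_card_le hcard).2 f
  exact ⟨c, fun x => by rw [← hc, hΦ]⟩

end FiniteField

section BudaghyanHelleseth

open scoped IsMulCommutative

variable {p h l d q : ℕ} [Fact p.Prime] {F : Type*} [Field F] [Finite F] [Algebra (ZMod p) F]

theorem frobPow_mul_smul (hq : q = p ^ h) (n : ℕ) (x : F) :
    frobPow p F (h * n) • x = x ^ q ^ n := by
  rw [frobPow_smul, hq, ← pow_mul]

theorem bhMul_eq_galMul (hq : q = p ^ h) (β ω : F) :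
    bhMul q l d β ω = galMul (frobPow p F (h * l)) (frobPow p F (h * d)) β ω := by
  funext x y
  simp only [galMul, bhMul, frobPow_mul_smul hq, mul_pow]

/-- The Budaghyan–Helleseth parameters satisfy the abstract conditions. -/
theorem isBHData (hp : p ≠ 2) (hh : 0 < h) (hl : 2 < l)
    (hld : Nat.Coprime l d) (hodd : Odd (l + d))
    (hq : q = p ^ h) (hF : Nat.card F = q ^ (2 * l))
    {β ω : F} (hβ : ¬ IsSquare β) (hω : ω ≠ 0) (hω' : ω + ω ^ q ^ l = 0) :
    IsBHData (frobPow p F (h * l)) (frobPow p F (h * d)) β ω := by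
  have : Fintype F := Fintype.ofFinite F
  have hc : CharP F p := charP_of_injective_algebraMap (algebraMap (ZMod p) F).injective p
  have hchar : ringChar F ≠ 2 := by rw [ringChar.eq F p]; exact hp
  have hqodd : Odd q := hq ▸ ((Fact.out : p.Prime).odd_of_ne_two hp).pow
  have hcard : Fintype.card F = q ^ l * q ^ l := by
    rw [← Nat.card_eq_fintype_card, hF, two_mul, pow_add]
  have hrank : Module.finrank (ZMod p) F = h * (2 * l) :=
    finrank_eq_of_card (by rw [hF, hq, ← pow_mul])
  have hone : ∀ n, frobPow p F (h * n) = 1 ↔ 2 * l ∣ n := fun n => by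
    rw [frobPow_eq_one_iff, hrank, Nat.mul_dvd_mul_iff_left hh]
  have hl2 : ∀ m n : ℕ, l + m * d = n → ¬ l ∣ m → ¬ 2 * l ∣ n := by
    intro m n hmn hm h1
    rw [← hmn] at h1
    have h2 : l ∣ m * d := (Nat.dvd_add_right (dvd_refl l)).mp ((dvd_mul_left l 2).trans h1)
    exact hm (hld.dvd_of_dvd_mul_right h2)
  refine ⟨Ring.two_ne_zero hchar, ?_, ?_, ?_, ?_, ?_, ?_, hω, ?_, hβ, ?_, ?_, ?_⟩
  · rw [frobPow_mul, ← mul_add, hone, two_mul]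
  · rw [ne_eq, hone]
    intro h1
    have := Nat.le_of_dvd (by omega) h1
    omega
  · rw [frobPow_mul, ← mul_add, ne_eq, hone]
    intro h1
    have h2 : l ∣ d := by
      rw [← two_mul] at h1
      exact (Nat.mul_dvd_mul_iff_left two_pos).mp h1
    have := Nat.dvd_gcd (dvd_refl l) h2
    rw [hld.gcd_eq_one] at this
    have := Nat.le_of_dvd one_pos this
    omega
  · rw [frobPow_mul, ← mul_add, ne_eq, hone]
    intro h1
    exact Nat.not_even_iff_odd.mpr hodd (even_iff_two_dvd.mpr ((dvd_mul_right 2 l).trans h1))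
  · rw [frobPow_mul, frobPow_mul, ← mul_add, ← mul_add, ne_eq, hone]
    refine hl2 2 _ (by ring) fun h1 => ?_
    have := Nat.le_of_dvd two_pos h1
    omega
  · rw [frobPow_mul, frobPow_mul, frobPow_mul, ← mul_add, ← mul_add, ← mul_add, ne_eq, hone]
    intro h1
    have h2 := (dvd_mul_right 2 l).trans h1
    rw [← even_iff_two_dvd, show l + (d + (d + d)) = (l + d) + (d + d) by ring] at h2
    exact Nat.not_even_iff_odd.mpr (hodd.add_even ⟨d, rfl⟩) h2
  · rw [frobPow_mul_smul hq]
    linear_combination hω'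
  · intro a ha
    rw [frobPow_mul_smul hq] at ha
    by_cases ha0 : a = 0
    · exact ha0 ▸ IsSquare.zero
    rw [FiniteField.isSquare_iff hchar ha0, hcard]
    obtain ⟨m, hm⟩ := hqodd.pow (n := l)
    have h3 : q ^ l * q ^ l / 2 = (2 * m) * (m + 1) := by
      rw [hm]
      have : (2 * m + 1) * (2 * m + 1) = 2 * (2 * m * (m + 1)) + 1 := by ring
      omega
    have h4 : a ^ (2 * m) = 1 := by
      rw [hm, pow_succ] at ha
      exact (mul_eq_right₀ ha0).mp ha
    rw [h3, pow_mul, h4, one_pow]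
  · intro y
    rw [frobPow_mul_smul hq, ← pow_succ']
    exact (hqodd.pow.add_one).isSquare_pow y
  · intro a ha
    rw [frobPow_mul_smul hq, frobPow_mul_smul hq, ← pow_mul, ← pow_add, add_comm] at ha
    rw [frobPow_mul_smul hq]
    refine pow_pow_eq_self (pow_eq_self_of_coprime (q := q) (m := l + d) (n := 2 * l) ?_ ha ?_) l
    · refine Nat.Coprime.mul_right hodd.coprime_two_right ?_
      rw [Nat.coprime_self_add_left]
      exact hld.symm
    · rw [← hF, Nat.card_eq_fintype_card, FiniteField.pow_card]

end BudaghyanHelleseth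

/-! ### The Budaghyan–Helleseth presemifield -/

section BudaghyanHelleseth

theorem card_units_of_card {F : Type*} [Field F] {q l : ℕ} (hF : Nat.card F = q ^ (2 * l)) (hq : 0 < q) :
    Nat.card Fˣ = (q ^ l - 1) * (q ^ l + 1) := by
  rw [Nat.card_units, hF, two_mul, pow_add]
  obtain ⟨e, he⟩ : ∃ e, q ^ l = e + 1 := ⟨q ^ l - 1, (Nat.sub_add_cancel (Nat.pow_pos hq)).symm⟩
  rw [he, Nat.add_sub_cancel, show (e + 1) * (e + 1) = e * (e + 1 + 1) + 1 by ring,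
    Nat.add_sub_cancel]

open scoped IsMulCommutative

variable {p h l d q : ℕ} [Fact p.Prime] {F : Type*} [Field F] [Finite F] [Algebra (ZMod p) F]

/-- For an automorphism `g = (x ↦ x ^ p ^ i)`, the condition on the factor of a strong monomial
reads `u ^ ((q ^ d + 1) * (q ^ l - 1)) = β ^ ((p ^ i - 1) * (q ^ l - 1))`. -/
theorem isStrongMonomial_frobPow_iff (hq : q = p ^ h) {i e j : ℕ} (he : q ^ l = e + 1)
    (hj : p ^ i = 2 * j + 1) (β u : Fˣ) :
    IsStrongMonomial (frobPow p F (h * l)) (frobPow p F (h * d)) (β : F) (frobPow p F i) u ↔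
      u ^ ((q ^ d + 1) * e) = (β ^ j) ^ (2 * e) := by
  rw [IsStrongMonomial, and_iff_right u.ne_zero, frobPow_mul_smul hq, frobPow_mul_smul hq,
    frobPow_mul_smul hq, frobPow_smul, he, hj, ← mul_left_inj (β ^ (2 * j + e + 2) * u ^ (q ^ d + 1)),
    Units.ext_iff]
  push_cast
  constructor
  · intro h1
    linear_combination h1
  · intro h1
    linear_combination h1

/-- Each automorphism carries `2 * (q ^ l - 1)` strong monomials: the exponent in the equation for `u`
has greatest common divisor `2 * (q ^ l - 1)` with the order of `Fˣ`, and the right-hand side is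
a power with that exponent since `p ^ i - 1` is even. -/
theorem card_isStrongMonomial (hp : p ≠ 2) (hld : Nat.Coprime l d) (hodd : Odd (l + d))
    (hq : q = p ^ h) (hF : Nat.card F = q ^ (2 * l)) {β : F} (hβ : β ≠ 0) (g : F ≃ₐ[ZMod p] F) :
    (∃ u, IsStrongMonomial (frobPow p F (h * l)) (frobPow p F (h * d)) β g u) ∧
    Nat.card {u // IsStrongMonomial (frobPow p F (h * l)) (frobPow p F (h * d)) β g u} =
      2 * (q ^ l - 1) := by
  obtain ⟨i, rfl⟩ := exists_eq_frobPow g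
  have hpodd : Odd p := (Fact.out : p.Prime).odd_of_ne_two hp
  have hqodd : Odd q := hq ▸ hpodd.pow
  obtain ⟨j, hj⟩ := hpodd.pow (n := i)
  obtain ⟨e, he⟩ : ∃ e, q ^ l = e + 1 :=
    ⟨q ^ l - 1, (Nat.sub_add_cancel (Nat.pow_pos hqodd.pos)).symm⟩
  lift β to Fˣ using hβ.isUnit
  have hiff := isStrongMonomial_frobPow_iff (F := F) (d := d) hq he hj β
  have hgcd : (Nat.card Fˣ).gcd ((q ^ d + 1) * e) = 2 * e := by
    rw [card_units_of_card hF hqodd.pos, mul_comm, he, Nat.add_sub_cancel, Nat.gcd_mul_right, ← he, gcd_pow_add_one_eq_two hqodd hld hodd]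
  obtain ⟨u, hu⟩ := exists_pow_eq_pow_gcd ((q ^ d + 1) * e) (β ^ j)
  rw [hgcd] at hu
  refine ⟨⟨u, (hiff u).mpr hu⟩, ?_⟩
  rw [he, Nat.add_sub_cancel, ← hgcd, ← card_pow_eq hu]
  exact Nat.card_congr
    ⟨fun v => ⟨Units.mk0 v.1 v.2.1, (hiff _).mp v.2⟩, fun y => ⟨y.1, (hiff _).mpr y.2⟩,
      fun _ => rfl, fun _ => Subtype.ext (Units.ext rfl)⟩

/-- The middle nucleus is not reduced to `𝔽_q`: the equation
`b ^ (q ^ (l + d) - 1) = β⁻¹ ^ (q ^ l - 1)` is solvable, because `gcd(2 l, l + d) = 1` and `q - 1`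
divides `q ^ l - 1`. -/
theorem exists_generator (hq : q = p ^ h) (hF : Nat.card F = q ^ (2 * l)) (hodd : Odd (l + d))
    (hld : Nat.Coprime l d) {β : F} (hβ : β ≠ 0) :
    ∃ b : F, b ≠ 0 ∧ β * frobPow p F (h * d) • b = frobPow p F (h * l) • (β * b) := by
  have hq0 : 0 < q := hq ▸ Nat.pow_pos (Fact.out : p.Prime).pos
  have hQQ : ∀ z : F, (z ^ q ^ l) ^ q ^ l = z := by
    intro z
    have : Fintype F := Fintype.ofFinite F
    rw [← pow_mul, ← pow_add, ← two_mul, ← hF, Nat.card_eq_fintype_card, FiniteField.pow_card]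
  lift β to Fˣ using hβ.isUnit
  have hgcd : (Nat.card Fˣ).gcd (q ^ (l + d) - 1) = q - 1 := by
    have h1 : (2 * l).gcd (l + d) = 1 := by
      refine Nat.Coprime.mul_left hodd.coprime_two_left ?_
      rwa [Nat.coprime_self_add_right]
    rw [Nat.card_units, hF, Nat.pow_sub_one_gcd_pow_sub_one, h1, pow_one]
  obtain ⟨c, hc⟩ : q - 1 ∣ q ^ l - 1 := by simpa using Nat.sub_dvd_pow_sub_pow q 1 l
  obtain ⟨b, hb⟩ := exists_pow_eq_pow_gcd (q ^ (l + d) - 1) (β⁻¹ ^ c)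
  rw [hgcd, ← pow_mul, mul_comm, ← hc] at hb
  have h1 : b ^ q ^ (l + d) * β ^ q ^ l = β * b := by
    rw [← Nat.sub_add_cancel (Nat.pow_pos hq0 : 0 < q ^ (l + d)), pow_succ, hb,
      ← Nat.sub_add_cancel (Nat.pow_pos hq0 : 0 < q ^ l), pow_succ, inv_pow, Nat.add_sub_cancel]
    rw [mul_mul_mul_comm, inv_mul_cancel, one_mul, mul_comm]
  have h2 : (b : F) ^ q ^ (l + d) * (β : F) ^ q ^ l = β * b := by
    have := congrArg (Units.val) h1
    push_cast at this
    exact this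
  refine ⟨b, b.ne_zero, ?_⟩
  rw [frobPow_mul_smul hq, frobPow_mul_smul hq, ← h2, mul_pow, hQQ, add_comm l d, pow_add, pow_mul,
    hQQ, mul_comm]

/-- The common fixed field of the `q ^ l`-th and `q ^ d`-th powers is `𝔽_q`, as `gcd(l, d) = 1`. -/
theorem card_biFixed (hh : 0 < h) (hld : Nat.Coprime l d)
    (hq : q = p ^ h) (hF : Nat.card F = q ^ (2 * l)) :
    Nat.card (biFixed F (frobPow p F (h * l)) (frobPow p F (h * d))) = q := by
  set E := biFixed F (frobPow p F (h * l)) (frobPow p F (h * d)) with hE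
  have hq1 : 1 < q := hq ▸ Nat.one_lt_pow hh.ne' (Fact.out : p.Prime).one_lt
  have hiff : ∀ y : Fˣ, y ^ (q - 1) = 1 ↔ (y : F) ∈ E := by
    intro y
    have h1 : y ^ (q - 1) = 1 ↔ (y : F) ^ q = y := by
      rw [← Nat.sub_add_cancel hq1.le, pow_succ, Nat.add_sub_cancel, mul_eq_right₀ y.ne_zero,
        Units.ext_iff]
      push_cast
      rfl
    rw [h1, hE, mem_biFixed, frobPow_mul_smul hq, frobPow_mul_smul hq]
    exact ⟨fun h2 => ⟨pow_pow_eq_self h2 l, pow_pow_eq_self h2 d⟩,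
      fun h2 => pow_eq_self_of_coprime hld h2.1 h2.2⟩
  have hgcd : (Nat.card Fˣ).gcd (q - 1) = q - 1 := by
    rw [Nat.card_units, hF]
    have : q - 1 ∣ q ^ (2 * l) - 1 := by simpa using Nat.sub_dvd_pow_sub_pow q 1 (2 * l)
    exact Nat.gcd_eq_right this
  have hcard : Nat.card Eˣ = q - 1 := by
    rw [← hgcd, ← card_pow_eq (one_pow (q - 1) : (1 : Fˣ) ^ (q - 1) = 1)]
    rw [Nat.card_congr unitsEquivNeZero]
    exact Nat.card_congr
      ⟨fun v => ⟨Units.mk0 v.1.1 fun h0 => v.2 (Subtype.ext h0), (hiff _).mpr v.1.2⟩,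
        fun y => ⟨⟨y.1, (hiff _).mp y.2⟩, fun h0 => y.1.ne_zero (congrArg Subtype.val h0)⟩,
        fun _ => rfl, fun _ => Subtype.ext (Units.ext rfl)⟩
  have := Nat.card_units E
  have : 0 < Nat.card E := Nat.card_pos
  omega

end BudaghyanHelleseth

section Autotopisms

open scoped IsMulCommutative

theorem mainTheorem4 {p h l d q : ℕ} [Fact p.Prime] (hp : p ≠ 2) (hh : 0 < h) (hl : 2 < l)
    (hd : 1 ≤ d) (hd' : d < 2 * l * h) (hld : Nat.Coprime l d) (hodd : Odd (l + d))
    (hq : q = p ^ h)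
    {F : Type*} [Field F] [Finite F] [Algebra (ZMod p) F] (hF : Nat.card F = q ^ (2 * l))
    (β ω : F) (hβ : ¬ IsSquare β) (hω : ω ≠ 0) (hω' : ω + ω ^ q ^ l = 0) :
    (∀ M N L : F ≃ₗ[ZMod p] F, IsAutotopism (bhMul q l d β ω) M N L →
      ∃ γ ∈ middleNucleus (bhSemifieldMul q l d β ω), γ ≠ 0 ∧
        ∃ N₀ : F ≃ₗ[ZMod p] F, IsStrongAutotopism (bhMul q l d β ω) N₀ L ∧
          ∀ x, bhMul q l d β ω (M x) 1 =
                bhSemifieldMul q l d β ω γ (bhMul q l d β ω (N₀ x) 1) ∧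
              bhMul q l d β ω (N₀ x) 1 =
                bhSemifieldMul q l d β ω γ (bhMul q l d β ω (N x) 1)) ∧
    Nat.card (autotopismGroup p (bhMul q l d β ω)) =
      2 * l * h * (q ^ l - 1) * (q ^ 2 - 1) := by
  have hps := isPresemifield_bhMul hp hld hodd hq hF hβ hω hω'
  have D := isBHData hp hh hl hld hodd hq hF hβ hω hω'
  have hstrong := card_isStrongMonomial (F := F) hp hld hodd hq hF D.beta_ne_zero
  have hq0 := card_biFixed (F := F) hh hld hq hF
  obtain ⟨b, hb0, hb⟩ := exists_generator (F := F) hq hF hodd hld D.beta_ne_zero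
  unfold bhSemifieldMul
  rw [bhMul_eq_galMul hq] at hps ⊢
  set κ := frobPow p F (h * l)
  set δ := frobPow p F (h * d)
  have hsq : ∀ a ∈ biFixed F κ δ, a ≠ 0 →
      ∃ s ∈ biFixed F κ δ, a = s * s ∨ a = s * s * (b * κ • b) := by
    intro a ha _
    have hns : ¬ IsSquare (⟨_, D.norm_mem hb⟩ : biFixed F κ δ) := by
      rintro ⟨s, hs⟩
      exact D.mul_self_ne_norm hb0 hb s.2 (congrArg Subtype.val hs).symm
    obtain ⟨s, hs⟩ := exists_sq_or_sq_mul hns ⟨a, ha⟩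
    exact ⟨s, s.2, hs.imp (congrArg Subtype.val) (congrArg Subtype.val)⟩
  refine ⟨D.exists_strong_up_to_middleNucleus hps exists_eq_galLin (fun g => (hstrong g).1)
    hb0 hb hsq, ?_⟩
  have hcount := D.two_mul_card_autotopism hps exists_eq_galLin (fun g => (hstrong g).1)
    hb0 hb hsq
  have hG : Nat.card (F ≃ₐ[ZMod p] F) = h * (2 * l) := by
    rw [IsGalois.card_aut_eq_finrank, finrank_eq_of_card (by rw [hF, hq, ← pow_mul])]
  have hz : Nat.card {z : biFixed F κ δ × biFixed F κ δ // z ≠ 0} = q ^ 2 - 1 := by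
    classical
    have := Nat.card_congr (Equiv.sumCompl fun z : biFixed F κ δ × biFixed F κ δ => z = 0)
    rw [Nat.card_sum, Nat.card_prod, hq0, Nat.card_unique] at this
    rw [sq]
    change Nat.card {z : biFixed F κ δ × biFixed F κ δ // ¬ z = 0} = _
    omega
  rw [Nat.card_prod, Nat.card_sigma, Finset.sum_congr rfl (fun g _ => (hstrong g).2),
    Finset.sum_const, Finset.card_univ, ← Nat.card_eq_fintype_card, hG, hz, smul_eq_mul] at hcount
  apply Nat.eq_of_mul_eq_mul_left two_pos
  refine Eq.trans hcount ?_
  ring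

end Autotopisms
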